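/- Let $P$ be a smooth finite-dimensional Hausdorff manifold without boundary, with a Poisson bivector field $\eta$. For covectors put $\langle\eta,\alpha\wedge\beta\rangle=\beta(\eta\alpha)$, where on the right $\eta$ is viewed as an antisymmetric map $T^*P\to TP$. The Poisson bracket of $P$ is $\{f,g\}=\langle\eta,df\wedge dg\rangle$, and $$[\alpha,\beta]=L_{\eta\alpha}\beta-L_{\eta\beta}\alpha-d\langle\eta,\alpha\wedge\beta\rangle$$ is the bracket of the cotangent Lie algebroid $T^*P$. Let $p:TP\to P$ be the projection and, for a $1$-form $\alpha$ on $P$, let $\tilde\alpha:TP\to\mathbb R$, $\tilde\alpha(v)=\alpha(v)$. Then there is exactly one Poisson structure $\{\,,\}_{TP}$ on the manifold $TP$ (the Lie–Poisson structure of $TP$ as the dual of the Lie algebroid $T^*P$) such that, for all closed smooth real $1$-forms $\alpha,\beta$ on $P$, all smooth $f,g:P\to\mathbb R$, all $x\in P$ and all $v\in T_xP$, $$\{\tilde\alpha,\tilde\beta\}_{TP}(v)=[\alpha,\beta](v),\qquad \{p^*f,p^*g\}_{TP}=0,\qquad \{\tilde\alpha,p^*f\}_{TP}(v)=df(\eta\,\alpha(x)).$$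 Let $\nabla$ be a smooth torsion-free connection on $TP$. For a smooth function $f$ on $TP$ and $v\in T_xP$, let $\partial_1f(v)$ and $\partial_2f(v)$ be the vertical and horizontal components of $df(v)$: the linear forms $u\mapsto\left.\frac{d}{dt}\right|_{t=0}f(v+tu)$ and $u\mapsto df(v)(u^{h})$ on $T_xP$, where $u^{h}\in T_v(TP)$ is the horizontal lift of $u$ defined by $\nabla$. Let $\mathfrak D\eta(v)\in\bigwedge^2T_xP$ be the vertical component of the image of $v$ under the derivative of the section $\eta:P\to\bigwedge^2TP$, that is, the covariant derivative $\nabla_v\eta$ for the induced connection on $\bigwedge^2TP$. Then, for all smooth functions $f,g$ on $TP$, real- or complex-valued (brackets and pairings being extended $\mathbb C$-bilinearly to the complex case), all $x\in P$ and all $v\in T_xP$, $$\{f,g\}_{TP}(v)=\langle\mathfrak D\eta(v),\partial_1f(v)\wedge\partial_1g(v)\rangle+\langle\eta(x),\partial_1f(v)\wedge\partial_2g(v)-\partial_1g(v)\wedge\partial_2f(v)\rangle.$$ -/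

import Mathlib

open Bundle FiberBundle VectorField
open scoped Manifold ContDiff

noncomputable section

section PoissonGeometry

variable {E : Type*} [NormedAddCommGroup E] [NormedSpace ℝ E]
  {H : Type*} [TopologicalSpace H] (I : ModelWithCorners ℝ E H)
  {M : Type*} [TopologicalSpace M] [ChartedSpace H M]

/-- The fibre `T*_x M` of the cotangent bundle, as a fibre of the bundle of continuous linear maps
from the tangent bundle to the trivial line bundle. -/
abbrev Cotangent (x : M) : Type _ := TangentSpace I x →L[ℝ] Bundle.Trivial M ℝ x

variable {I}

/-- The bracket `{f, g} = ⟨η, df ∧ dg⟩ = dg (η df)` defined by a field `η` of linear maps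
`T*_x M → T_x M`. -/
def bivectorBracket (η : ∀ x : M, (TangentSpace I x →L[ℝ] ℝ) →ₗ[ℝ] TangentSpace I x)
    (f g : M → ℝ) (x : M) : ℝ :=
  mvfderiv I g x (η x (mvfderiv I f x))

variable (I M)

/-- A Poisson structure on the manifold `M`: a smooth bivector field `η`, seen as a field of
antisymmetric maps `T*_x M → T_x M`, whose bracket satisfies the Jacobi identity.
Smoothness of `η` is expressed by the fact that the bracket of smooth functions is smooth. -/
@[ext]
structure PoissonStructure where
  /-- the bivector field, as an antisymmetric map from the cotangent to the tangent bundle -/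
  sharp : ∀ x : M, (TangentSpace I x →L[ℝ] ℝ) →ₗ[ℝ] TangentSpace I x
  antisymm : ∀ (x : M) (a b : TangentSpace I x →L[ℝ] ℝ), b (sharp x a) = -a (sharp x b)
  smooth : ∀ f g : M → ℝ, ContMDiff I 𝓘(ℝ, ℝ) ∞ f → ContMDiff I 𝓘(ℝ, ℝ) ∞ g →
    ContMDiff I 𝓘(ℝ, ℝ) ∞ (bivectorBracket sharp f g)
  jacobi : ∀ f g h : M → ℝ, ContMDiff I 𝓘(ℝ, ℝ) ∞ f → ContMDiff I 𝓘(ℝ, ℝ) ∞ g →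
    ContMDiff I 𝓘(ℝ, ℝ) ∞ h → ∀ x : M,
    bivectorBracket sharp f (bivectorBracket sharp g h) x +
      bivectorBracket sharp g (bivectorBracket sharp h f) x +
      bivectorBracket sharp h (bivectorBracket sharp f g) x = 0

variable {I M}

/-- The bivector `η(x) ∈ ⋀² T_x M` as a bilinear form on `T*_x M`: `⟨η(x), a ∧ b⟩ = b (η a)`. -/
def PoissonStructure.bivector (η : PoissonStructure I M) (x : M)
    (a b : TangentSpace I x →L[ℝ] ℝ) : ℝ :=
  b (η.sharp x a)

/-- The Poisson bracket of two real functions. -/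
def PoissonStructure.bracket (η : PoissonStructure I M) (f g : M → ℝ) : M → ℝ :=
  bivectorBracket η.sharp f g

/-- The pairing `⟨B, a ∧ b⟩` of a real bivector `B` on `V`, given as a bilinear form on the dual
of `V`, with `𝕜`-valued covectors, `𝕜 = ℝ` or `ℂ`: the `𝕜`-bilinear extension of `B`. -/
def pairWedge {𝕜 : Type*} [RCLike 𝕜] {V : Type*} [AddCommGroup V] [Module ℝ V]
    [TopologicalSpace V] (B : (V →L[ℝ] ℝ) → (V →L[ℝ] ℝ) → ℝ) (a b : V →L[ℝ] 𝕜) : 𝕜 :=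
  let re (c : V →L[ℝ] 𝕜) : V →L[ℝ] ℝ := RCLike.reCLM ∘L c
  let im (c : V →L[ℝ] 𝕜) : V →L[ℝ] ℝ := RCLike.imCLM ∘L c
  ((B (re a) (re b) - B (im a) (im b) : ℝ) : 𝕜) +
    ((B (re a) (im b) + B (im a) (re b) : ℝ) : 𝕜) * RCLike.I

/-- The Poisson bracket of two `𝕜`-valued functions, `𝕜 = ℝ` or `ℂ`. -/
def PoissonStructure.bracketRC {𝕜 : Type*} [RCLike 𝕜] (η : PoissonStructure I M)
    (f g : M → 𝕜) (x : M) : 𝕜 :=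
  pairWedge (η.bivector x) (mvfderiv I f x) (mvfderiv I g x)

theorem PoissonStructure.bracketRC_real (η : PoissonStructure I M) (f g : M → ℝ) :
    η.bracketRC f g = η.bracket f g := by
  ext x
  have h (c : TangentSpace I x →L[ℝ] ℝ) : (RCLike.reCLM : ℝ →L[ℝ] ℝ) ∘L c = c := by
    ext u; simp
  have h' (c : TangentSpace I x →L[ℝ] ℝ) : (RCLike.imCLM : ℝ →L[ℝ] ℝ) ∘L c = 0 := by
    ext u; simp
  simp [bracketRC, pairWedge, bivector, bracket, bivectorBracket, h, h']

section LieAlgebroid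

variable [IsManifold I ∞ M]

/-- Smooth `1`-forms. -/
def IsSmoothForm (α : ∀ x : M, Cotangent I x) : Prop :=
  ContMDiff I (I.prod 𝓘(ℝ, E →L[ℝ] ℝ)) ∞ (fun x ↦ TotalSpace.mk' (E →L[ℝ] ℝ) x (α x))

/-- Closed `1`-forms: `dα(X, Y) = X (α Y) - Y (α X) - α [X, Y]` vanishes. -/
def IsClosedForm (α : ∀ x : M, Cotangent I x) : Prop :=
  ∀ (x : M) (X Y : ∀ y : M, TangentSpace I y), MDiffAt (T% X) x → MDiffAt (T% Y) x →
    mvfderiv I (fun y ↦ (α y (Y y) : ℝ)) x (X x) - mvfderiv I (fun y ↦ (α y (X y) : ℝ)) x (Y x)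
      - α x (mlieBracket I X Y x) = 0

/-- The value on `v ∈ T_x M` of the Lie derivative of the form `β` along the vector field `X`:
`(L_X β)(Z) = X (β Z) - β [X, Z]`, where `Z` is any vector field with `Z x = v`. -/
def lieDerivForm (X : ∀ x : M, TangentSpace I x) (β : ∀ x : M, Cotangent I x) (x : M)
    (v : TangentSpace I x) : ℝ :=
  mvfderiv I (fun y ↦ (β y (extend E v y) : ℝ)) x (X x) - β x (mlieBracket I X (extend E v) x)

/-- The bracket of `1`-forms on a Poisson manifold, that is, the bracket of the Lie algebroid
`T*M`: `[α, β] = L_{ηα} β - L_{ηβ} α - d (η(α, β))`. -/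
def PoissonStructure.formBracket (η : PoissonStructure I M) (α β : ∀ x : M, Cotangent I x)
    (x : M) (v : TangentSpace I x) : ℝ :=
  lieDerivForm (fun y ↦ η.sharp y (α y)) β x v - lieDerivForm (fun y ↦ η.sharp y (β y)) α x v
    - mvfderiv I (fun y ↦ η.bivector y (α y) (β y)) x v

/-- The function `v ↦ α(v)` on the tangent bundle defined by a `1`-form. -/
def formFun (α : ∀ x : M, Cotangent I x) : TangentBundle I M → ℝ :=
  fun v ↦ α v.proj v.2

/-- `θ` is the Lie–Poisson structure on `TM`, the dual of the Lie algebroid `T*M` of the Poisson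
manifold `(M, η)`: it is the Poisson structure on the manifold `TM` whose bracket satisfies
`{α̃, β̃}(v) = [α, β](v)`, `{p^*f, p^*g} = 0` and `{α̃, p^*f}(v) = η(α(x)) · f` for closed `1`-forms
`α`, `β` and smooth functions `f`, `g` on `M`. -/
structure IsLiePoisson (η : PoissonStructure I M)
    (θ : PoissonStructure I.tangent (TangentBundle I M)) : Prop where
  form_form : ∀ α β : (∀ x : M, Cotangent I x), IsSmoothForm α → IsClosedForm α →
    IsSmoothForm β → IsClosedForm β → ∀ v : TangentBundle I M,
    θ.bracket (formFun α) (formFun β) v = η.formBracket α β v.proj v.2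
  fun_fun : ∀ f g : M → ℝ, ContMDiff I 𝓘(ℝ, ℝ) ∞ f → ContMDiff I 𝓘(ℝ, ℝ) ∞ g →
    ∀ v : TangentBundle I M, θ.bracket (fun w ↦ f w.proj) (fun w ↦ g w.proj) v = 0
  form_fun : ∀ (α : ∀ x : M, Cotangent I x) (f : M → ℝ), IsSmoothForm α → IsClosedForm α →
    ContMDiff I 𝓘(ℝ, ℝ) ∞ f → ∀ v : TangentBundle I M,
    θ.bracket (formFun α) (fun w ↦ f w.proj) v =
      mvfderiv I f v.proj (η.sharp v.proj (α v.proj))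

end LieAlgebroid

section Splitting

variable [IsManifold I ∞ M]

/-- The vertical lift `T_x M → T_v(TM)` at `v ∈ T_x M`, `u ↦ d/dt (v + t u)` at `t = 0`: the
derivative at `v` of the inclusion of the fibre `T_x M` in `TM`. -/
def verticalLift (v : TangentBundle I M) :
    TangentSpace I v.proj →L[ℝ] TangentSpace I.tangent v :=
  mfderiv 𝓘(ℝ, E) I.tangent (fun w : E ↦ (⟨v.proj, w⟩ : TangentBundle I M)) v.2

/-- The derivative `X_* : T_x M → T_v(TM)` at `x` of a vector field `X : M → TM` with `X x = v`. -/
def fieldDeriv (X : ∀ y : M, TangentSpace I y) (v : TangentBundle I M) (_h : X v.proj = v.2) :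
    TangentSpace I v.proj →L[ℝ] TangentSpace I.tangent v :=
  show TangentSpace I v.proj →L[ℝ] TangentSpace I.tangent (⟨v.proj, X v.proj⟩ : TangentBundle I M)
    from mfderiv I I.tangent (fun y ↦ (⟨y, X y⟩ : TangentBundle I M)) v.proj

variable (cov : CovariantDerivative I E (TangentSpace I : M → Type _))

/-- The horizontal lift `T_x M → T_v(TM)` at `v ∈ T_x M` defined by a connection: it sends `u` to
`X_* u - (∇_u X)^vert`, where `X` is any vector field with `X x = v`. In particular it sends `u` to
`X_* u` if moreover `∇_u X = 0`. -/
def horizontalLift (v : TangentBundle I M) :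
    TangentSpace I v.proj →L[ℝ] TangentSpace I.tangent v :=
  fieldDeriv (extend E v.2) v (extend_apply_self E v.2) - verticalLift v ∘L cov (extend E v.2) v.proj

variable {F : Type*} [NormedAddCommGroup F] [NormedSpace ℝ F]

/-- The vertical component `∂₁f(v)` of the differential of a function on `TM`. -/
def dVert (f : TangentBundle I M → F) (v : TangentBundle I M) :
    TangentSpace I v.proj →L[ℝ] F :=
  mvfderiv I.tangent f v ∘L verticalLift v

/-- The horizontal component `∂₂f(v)` of the differential of a function on `TM`. -/
def dHor (f : TangentBundle I M → F) (v : TangentBundle I M) :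
    TangentSpace I v.proj →L[ℝ] F :=
  mvfderiv I.tangent f v ∘L horizontalLift cov v

end Splitting

section InducedConnection

variable [IsManifold I ∞ M]

/-- Differentiability at a point of a `1`-form, as a section of the cotangent bundle. -/
def DiffFormAt (α : ∀ x : M, Cotangent I x) (x : M) : Prop :=
  MDifferentiableAt I (I.prod 𝓘(ℝ, E →L[ℝ] ℝ))
    (fun y ↦ TotalSpace.mk' (E →L[ℝ] ℝ) (E := Cotangent I) y (α y)) x

theorem DiffFormAt.apply {α : ∀ x : M, Cotangent I x} {x : M} (hα : DiffFormAt α x)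
    {X : ∀ y : M, TangentSpace I y} (hX : MDiffAt (T% X) x) :
    MDifferentiableAt I 𝓘(ℝ, ℝ) (fun y ↦ (α y (X y) : ℝ)) x := by
  have h := MDifferentiableAt.clm_bundle_apply (b := fun y : M ↦ y) (E₁ := TangentSpace I)
    (E₂ := Bundle.Trivial M ℝ) hα hX
  rw [mdifferentiableAt_totalSpace] at h
  exact h.2

theorem diffFormAt_extend {x : M} (a : Cotangent I x) :
    DiffFormAt (extend (E := Cotangent I) (E →L[ℝ] ℝ) a) x :=
  mdifferentiableAt_extend I (E →L[ℝ] ℝ) a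

variable (cov : CovariantDerivative I E (TangentSpace I : M → Type _))

theorem tensorialAt_covDerivForm {α : ∀ x : M, Cotangent I x} {x : M} (hα : DiffFormAt α x)
    (u : TangentSpace I x) :
    TensorialAt I E (fun X : (∀ y : M, TangentSpace I y) ↦
      mvfderiv I (fun y ↦ (α y (X y) : ℝ)) x u - (α x (cov X x u) : ℝ)) x where
  smul := by
    intro f X hf hX
    have h := mvfderiv_mul hf (hα.apply hX)
    have h2 : (fun y ↦ (α y ((f • X) y) : ℝ)) = f * fun y ↦ (α y (X y) : ℝ) := by
      ext y; exact (α y).map_smul (f y) (X y)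
    have h3 := cov.isCovariantDerivativeOn (s := Set.univ) |>.leibniz hX hf
    rw [h2, h, h3]
    have h4 : (α x ((f x • cov X x + (mvfderiv I f x).smulRight (X x)) u) : ℝ)
        = f x * (α x (cov X x u) : ℝ) + mvfderiv I f x u * (α x (X x) : ℝ) := by
      exact ((α x).map_add _ _).trans
        (congrArg₂ (· + ·) ((α x).map_smul _ _) ((α x).map_smul _ _))
    rw [h4]
    simp only [add_apply, smul_apply, smul_eq_mul]
    ring
  add := by
    intro X Y hX hY
    have h := mvfderiv_add (hα.apply hX) (hα.apply hY)
    have h2 : (fun y ↦ (α y ((X + Y) y) : ℝ)) =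
        (fun y ↦ (α y (X y) : ℝ)) + fun y ↦ (α y (Y y) : ℝ) := by
      ext y; exact (α y).map_add (X y) (Y y)
    have h3 := cov.isCovariantDerivativeOn (s := Set.univ) |>.add hX hY
    rw [h2, h, h3]
    have h4 : (α x ((cov X x + cov Y x) u) : ℝ) = (α x (cov X x u) : ℝ) + (α x (cov Y x u) : ℝ) :=
      (α x).map_add _ _
    rw [h4]
    simp only [add_apply]
    ring

variable [FiniteDimensional ℝ E]

/-- The connection induced on the cotangent bundle: the covector `∇_u α` at `x`, given by
`(∇_u α)(X x) = u (α X) - α (∇_u X)` for any vector field `X`. -/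
def covDerivForm (α : ∀ x : M, Cotangent I x) {x : M} (hα : DiffFormAt α x)
    (u : TangentSpace I x) : TangentSpace I x →L[ℝ] ℝ :=
  TensorialAt.mkHom _ x (tensorialAt_covDerivForm cov hα u)

theorem covDerivForm_apply {α : ∀ x : M, Cotangent I x} {x : M} (hα : DiffFormAt α x)
    (u : TangentSpace I x) {X : ∀ y : M, TangentSpace I y} (hX : MDiffAt (T% X) x) :
    covDerivForm cov α hα u (X x) =
      mvfderiv I (fun y ↦ (α y (X y) : ℝ)) x u - (α x (cov X x u) : ℝ) :=
  TensorialAt.mkHom_apply (tensorialAt_covDerivForm cov hα u) hX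

/-- The vertical component `𝔇η(v) ∈ ⋀² T_x M`, `v ∈ T_x M`, of the derivative of the section `η` of
the bundle `⋀² TM`, for the splitting of the tangent spaces of `⋀² TM` defined by the connection.
That is, the covariant derivative `∇_v η` for the induced connection on `⋀² TM`:
`⟨𝔇η(v), α ∧ β⟩ = v ⟨η, α ∧ β⟩ - ⟨η, ∇_v α ∧ β⟩ - ⟨η, α ∧ ∇_v β⟩`, where `α`, `β` are any
`1`-forms with the given values at `x`. -/
def PoissonStructure.vertDeriv (η : PoissonStructure I M) (v : TangentBundle I M)
    (a b : TangentSpace I v.proj →L[ℝ] ℝ) : ℝ :=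
  let α : ∀ y : M, Cotangent I y := extend (E := Cotangent I) (E →L[ℝ] ℝ) (x := v.proj) a
  let β : ∀ y : M, Cotangent I y := extend (E := Cotangent I) (E →L[ℝ] ℝ) (x := v.proj) b
  mvfderiv I (fun y ↦ η.bivector y (α y) (β y)) v.proj v.2
    - η.bivector v.proj (covDerivForm cov α (diffFormAt_extend a) v.2) b
    - η.bivector v.proj a (covDerivForm cov β (diffFormAt_extend b) v.2)

end InducedConnection

end PoissonGeometry

end

noncomputable section

section Calculus

variable {E : Type*} [NormedAddCommGroup E] [NormedSpace ℝ E]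
  {H : Type*} [TopologicalSpace H] {I : ModelWithCorners ℝ E H}
  {M : Type*} [TopologicalSpace M] [ChartedSpace H M]

theorem mvfderiv_congr {F : Type*} [NormedAddCommGroup F] [NormedSpace ℝ F] {f g : M → F} {x : M}
    (h : f =ᶠ[nhds x] g) : mvfderiv I f x = mvfderiv I g x := by
  ext u
  exact congrArg (fun L : E →L[ℝ] F ↦ L u) (Filter.EventuallyEq.mfderiv_eq (I := I) (I' := 𝓘(ℝ, F)) h)

theorem contMDiff_mdifferentiableAt {F : Type*} [NormedAddCommGroup F] [NormedSpace ℝ F]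
    {f : M → F} (hf : ContMDiff I 𝓘(ℝ, F) ∞ f) (x : M) : MDifferentiableAt I 𝓘(ℝ, F) f x :=
  hf.mdifferentiable (by simp) x

variable [IsManifold I ∞ M]

/-- On a finite-dimensional Hausdorff manifold, every covector is the differential of a globally
defined smooth function. -/
theorem exists_contMDiff_mvfderiv_eq [FiniteDimensional ℝ E] [T2Space M] (x : M)
    (a : TangentSpace I x →L[ℝ] ℝ) :
    ∃ f : M → ℝ, ContMDiff I 𝓘(ℝ, ℝ) ∞ f ∧ mvfderiv I f x = a := by
  let L : E →L[ℝ] ℝ := a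
  let ρ : SmoothBumpFunction I x := Classical.choice inferInstance
  refine ⟨fun y ↦ ρ y • L (extChartAt I x y), ?_, ?_⟩
  · refine ρ.contMDiff_smul fun y hy ↦ ?_
    exact L.contMDiff.contMDiffAt.comp_contMDiffWithinAt y
      (contMDiffAt_extChartAt' hy).contMDiffWithinAt
  · have h : (fun y ↦ ρ y • L (extChartAt I x y)) =ᶠ[nhds x] (L ∘ extChartAt I x) := by
      filter_upwards [ρ.eventuallyEq_one] with y hy
      simp [hy]
    rw [mvfderiv_congr h]
    ext u
    have h1 : MDifferentiableAt 𝓘(ℝ, E) 𝓘(ℝ, ℝ) L (extChartAt I x x) :=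
      L.differentiableAt.mdifferentiableAt
    rw [mvfderiv_comp_apply x h1 (mdifferentiableAt_extChartAt (mem_chart_source H x)),
      mfderiv_extChartAt_self]
    change mfderiv 𝓘(ℝ, E) 𝓘(ℝ, ℝ) L _ _ = _
    rw [mfderiv_eq_fderiv, L.fderiv]
    rfl

/-- In the chart at `x` the differential of a function is the differential of its expression
in coordinates. -/
theorem mvfderiv_eq_fderiv_extChartAt [I.Boundaryless] {f : M → ℝ} {x y : M}
    (hf : MDifferentiableAt I 𝓘(ℝ, ℝ) f y) (hy : y ∈ (extChartAt I x).source)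
    (w : TangentSpace I y) :
    mvfderiv I f y w = fderiv ℝ (f ∘ (extChartAt I x).symm) (extChartAt I x y)
      (mfderiv I 𝓘(ℝ, E) (extChartAt I x) y w) := by
  have hy' : (extChartAt I x).symm (extChartAt I x y) = y := (extChartAt I x).left_inv hy
  have hs : MDifferentiableAt 𝓘(ℝ, E) I (extChartAt I x).symm (extChartAt I x y) := by
    have := mdifferentiableWithinAt_extChartAt_symm ((extChartAt I x).map_source hy)
    rwa [I.range_eq_univ, mdifferentiableWithinAt_univ] at this
  have h1 : MDifferentiableAt 𝓘(ℝ, E) 𝓘(ℝ, ℝ) (f ∘ (extChartAt I x).symm) (extChartAt I x y) := by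
    refine MDifferentiableAt.comp (I' := I) _ ?_ hs
    rwa [hy']
  have h : f =ᶠ[nhds y] (f ∘ (extChartAt I x).symm) ∘ extChartAt I x := by
    filter_upwards [(isOpen_extChartAt_source x).mem_nhds hy] with z hz
    simp only [Function.comp, (extChartAt I x).left_inv hz]
  rw [mvfderiv_congr h,
    mvfderiv_comp_apply y h1 (mdifferentiableAt_extChartAt (by simpa using hy))]
  change mfderiv 𝓘(ℝ, E) 𝓘(ℝ, ℝ) _ _ _ = _
  rw [mfderiv_eq_fderiv]
  rfl

end Calculus

section LieBracket

variable {E : Type*} [NormedAddCommGroup E] [NormedSpace ℝ E]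
  {H : Type*} [TopologicalSpace H] {I : ModelWithCorners ℝ E H}
  {M : Type*} [TopologicalSpace M] [ChartedSpace H M]

theorem fderiv_lieBracket {g : E → ℝ} {X Y : E → E} {p : E} (hg : ContDiffAt ℝ ∞ g p)
    (hX : DifferentiableAt ℝ X p) (hY : DifferentiableAt ℝ Y p) :
    fderiv ℝ g p (lieBracket ℝ X Y p) =
      fderiv ℝ (fun q ↦ fderiv ℝ g q (Y q)) p (X p) -
        fderiv ℝ (fun q ↦ fderiv ℝ g q (X q)) p (Y p) := by
  have hg2 : DifferentiableAt ℝ (fderiv ℝ g) p :=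
    (hg.fderiv_right (m := 1) (by norm_cast)).differentiableAt (by simp)
  have hsymm := (hg.isSymmSndFDerivAt (by simp; norm_cast)) (X p) (Y p)
  rw [fderiv_clm_apply hg2 hX, fderiv_clm_apply hg2 hY, lieBracket_eq]
  simp only [add_apply, ContinuousLinearMap.comp_apply, ContinuousLinearMap.flip_apply, map_sub]
  linarith

variable (I) in
/-- The expression of a vector field in the chart at `x`. -/
def fieldInChart (x : M) (Z : ∀ y : M, TangentSpace I y) : E → E :=
  mpullbackWithin 𝓘(ℝ, E) I (extChartAt I x).symm Z (Set.range I)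

variable [IsManifold I ∞ M]

theorem fieldInChart_self (x : M) (Z : ∀ y : M, TangentSpace I y) :
    fieldInChart I x Z (extChartAt I x x) = Z x := by
  rw [fieldInChart, mpullbackWithin_apply, extChartAt_to_inv]
  exact mfderivWithin_extChartAt_symm_inverse_apply _

variable [I.Boundaryless]

theorem mfderiv_extChartAt_mlieBracket (x : M) (X Y : ∀ y : M, TangentSpace I y) :
    mfderiv I 𝓘(ℝ, E) (extChartAt I x) x (mlieBracket I X Y x) =
      lieBracket ℝ (fieldInChart I x X) (fieldInChart I x Y) (extChartAt I x x) := by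
  rw [← mlieBracketWithin_univ, mlieBracketWithin_apply]
  refine ((isInvertible_mfderiv_extChartAt (mem_extChartAt_source x)).self_apply_inverse _).trans ?_
  change lieBracketWithin ℝ (fieldInChart I x X) (fieldInChart I x Y) _ _ = _
  rw [I.range_eq_univ, Set.preimage_univ, Set.inter_univ, lieBracketWithin_univ]

variable [CompleteSpace E]

theorem differentiableAt_fieldInChart {x : M} {Z : ∀ y : M, TangentSpace I y}
    (hZ : MDiffAt (T% Z) x) : DifferentiableAt ℝ (fieldInChart I x Z) (extChartAt I x x) := by
  rw [← mdifferentiableWithinAt_univ] at hZ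
  have : DifferentiableWithinAt ℝ (fieldInChart I x Z)
      ((extChartAt I x).symm ⁻¹' Set.univ ∩ Set.range I) (extChartAt I x x) :=
    hZ.differentiableWithinAt_mpullbackWithin_vectorField
  rwa [I.range_eq_univ, Set.preimage_univ, Set.inter_univ, differentiableWithinAt_univ] at this

theorem mvfderiv_apply_field_eq_fderiv {f : M → ℝ} (hf : ContMDiff I 𝓘(ℝ, ℝ) ∞ f) {x : M}
    {Z : ∀ y : M, TangentSpace I y} (hZ : MDiffAt (T% Z) x) (w : TangentSpace I x) :
    mvfderiv I (fun y ↦ mvfderiv I f y (Z y)) x w =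
      fderiv ℝ (fun p ↦ fderiv ℝ (f ∘ (extChartAt I x).symm) p (fieldInChart I x Z p))
        (extChartAt I x x) w := by
  have hf1 : ContDiffAt ℝ ∞ (f ∘ (extChartAt I x).symm) (extChartAt I x x) :=
    (hf.contMDiffAt.comp _ ((contMDiffOn_extChartAt_symm (n := ∞) (I := I) x).contMDiffAt
      ((isOpen_extChartAt_target x).mem_nhds (mem_extChartAt_target x)))).contDiffAt
  have hZe := eventuallyEq_mpullback_mpullbackWithin_extChartAt (s := Set.univ) (x := x) Z
  rw [nhdsWithin_univ] at hZe
  have h : (fun y ↦ mvfderiv I f y (Z y)) =ᶠ[nhds x]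
      (fun p ↦ fderiv ℝ (f ∘ (extChartAt I x).symm) p (fieldInChart I x Z p)) ∘
        extChartAt I x := by
    filter_upwards [hZe, extChartAt_source_mem_nhds (I := I) x] with y hy hy'
    rw [mvfderiv_eq_fderiv_extChartAt (contMDiff_mdifferentiableAt hf y) hy']
    simp only [Function.comp]
    congr 1
    rw [hy, mpullback_apply]
    exact (isInvertible_mfderiv_extChartAt hy').self_apply_inverse _
  have hd2 : DifferentiableAt ℝ (fun p ↦ fderiv ℝ (f ∘ (extChartAt I x).symm) p
      (fieldInChart I x Z p)) (extChartAt I x x) :=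
    ((hf1.fderiv_right (m := 1) (by norm_cast)).differentiableAt (by simp)).clm_apply
      (differentiableAt_fieldInChart hZ)
  rw [mvfderiv_congr h, mvfderiv_comp_apply x hd2.mdifferentiableAt
    (mdifferentiableAt_extChartAt (mem_chart_source H x)), mfderiv_extChartAt_self]
  change mfderiv 𝓘(ℝ, E) 𝓘(ℝ, ℝ) _ _ _ = _
  rw [mfderiv_eq_fderiv]
  rfl

/-- The Lie bracket of two vector fields is the commutator of the corresponding derivations. -/
theorem mvfderiv_mlieBracket {f : M → ℝ} (hf : ContMDiff I 𝓘(ℝ, ℝ) ∞ f)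
    {X Y : ∀ x : M, TangentSpace I x} {x : M} (hX : MDiffAt (T% X) x) (hY : MDiffAt (T% Y) x) :
    mvfderiv I f x (mlieBracket I X Y x) =
      mvfderiv I (fun y ↦ mvfderiv I f y (Y y)) x (X x) -
        mvfderiv I (fun y ↦ mvfderiv I f y (X y)) x (Y x) := by
  have hf1 : ContDiffAt ℝ ∞ (f ∘ (extChartAt I x).symm) (extChartAt I x x) :=
    (hf.contMDiffAt.comp _ ((contMDiffOn_extChartAt_symm (n := ∞) (I := I) x).contMDiffAt
      ((isOpen_extChartAt_target x).mem_nhds (mem_extChartAt_target x)))).contDiffAt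
  rw [mvfderiv_eq_fderiv_extChartAt (contMDiff_mdifferentiableAt hf x) (mem_extChartAt_source x),
    mfderiv_extChartAt_mlieBracket, mvfderiv_apply_field_eq_fderiv hf hX,
    mvfderiv_apply_field_eq_fderiv hf hY, ← fieldInChart_self x X, ← fieldInChart_self x Y]
  exact fderiv_lieBracket hf1 (differentiableAt_fieldInChart hX) (differentiableAt_fieldInChart hY)

end LieBracket

section Frame

variable {E : Type*} [NormedAddCommGroup E] [NormedSpace ℝ E]
  {H : Type*} [TopologicalSpace H] (I : ModelWithCorners ℝ E H)
  {M : Type*} [TopologicalSpace M] [ChartedSpace H M]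

/-- A set of smooth functions whose differentials exhaust every cotangent space. -/
structure GeneratesCotangent (A : Set (M → ℝ)) : Prop where
  smooth : ∀ f ∈ A, ContMDiff I 𝓘(ℝ, ℝ) ∞ f
  exists_eq : ∀ (x : M) (a : TangentSpace I x →L[ℝ] ℝ), ∃ f ∈ A, mvfderiv I f x = a

variable {I} [IsManifold I ∞ M] [I.Boundaryless]

theorem contDiffAt_comp_extChartAt_symm {f : M → ℝ} {x : M}
    (hf : ContMDiffAt I 𝓘(ℝ, ℝ) ∞ f x) :
    ContDiffAt ℝ ∞ (f ∘ (extChartAt I x).symm) (extChartAt I x x) := by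
  have h := (contMDiffOn_extChartAt_symm (n := ∞) (I := I) x).contMDiffAt
      ((isOpen_extChartAt_target x).mem_nhds (mem_extChartAt_target x))
  refine (ContMDiffAt.comp (I' := I) _ ?_ h).contDiffAt
  rwa [extChartAt_to_inv]

variable [FiniteDimensional ℝ E]

/-- Near any point, the differentials of finitely many members of a generating set form a smooth
frame of the cotangent bundle. -/
theorem GeneratesCotangent.exists_frame {A : Set (M → ℝ)} (hA : GeneratesCotangent I A) (x : M) :
    ∃ F : Fin (Module.finrank ℝ E) → M → ℝ, (∀ i, F i ∈ A) ∧
      ∀ f : M → ℝ, ContMDiffAt I 𝓘(ℝ, ℝ) ∞ f x →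
        ∃ c : Fin (Module.finrank ℝ E) → M → ℝ, (∀ i, ContMDiffAt I 𝓘(ℝ, ℝ) ∞ (c i) x) ∧
          ∀ᶠ y in nhds x, mvfderiv I f y = ∑ i, c i y • mvfderiv I (F i) y := by
  let b := Module.finBasis ℝ E
  have hb : ∀ i, ∃ f ∈ A, mvfderiv I f x = (b.coord i).toContinuousLinearMap := fun i ↦
    hA.exists_eq x _
  choose F hFA hF using hb
  refine ⟨F, hFA, fun f hf ↦ ?_⟩
  let D : (M → ℝ) → E → E →L[ℝ] ℝ := fun g ↦ fderiv ℝ (g ∘ (extChartAt I x).symm)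
  let G : E → E →L[ℝ] E := fun p ↦ ∑ i, (D (F i) p).smulRight (b i)
  have hD : ∀ g : M → ℝ, ContMDiffAt I 𝓘(ℝ, ℝ) ∞ g x → ContDiffAt ℝ ∞ (D g) (extChartAt I x x) :=
    fun g hg ↦ (contDiffAt_comp_extChartAt_symm hg).fderiv_right (m := ∞) (by simp)
  have hG : ContDiffAt ℝ ∞ G (extChartAt I x x) :=
    ContDiffAt.sum fun i _ ↦ (hD (F i) (hA.smooth _ (hFA i)).contMDiffAt).smulRight
      contDiffAt_const
  have hG0 : G (extChartAt I x x) = ContinuousLinearMap.id ℝ E := by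
    ext u
    have h1 : ∀ i, D (F i) (extChartAt I x x) u = b.coord i u := fun i ↦ by
      have h2 := mvfderiv_eq_fderiv_extChartAt
        (contMDiff_mdifferentiableAt (hA.smooth _ (hFA i)) x) (mem_extChartAt_source x)
        (show TangentSpace I x from u)
      rw [hF, mfderiv_extChartAt_self] at h2
      exact h2.symm
    simp only [G, sum_apply, ContinuousLinearMap.smulRight_apply, h1]
    simp [b.sum_repr u]
  have hGinv : ContDiffAt ℝ ∞ (fun p ↦ (G p).inverse) (extChartAt I x x) := by
    have h2 := contDiffAt_map_inverse (𝕜 := ℝ) (n := ∞) (ContinuousLinearEquiv.refl ℝ E)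
    refine ContDiffAt.comp (g := ContinuousLinearMap.inverse) _ ?_ hG
    rw [hG0]
    exact h2
  have hGev : ∀ᶠ p in nhds (extChartAt I x x), (G p).IsInvertible := by
    have h3 := (ContinuousLinearEquiv.nhds (ContinuousLinearEquiv.refl ℝ E))
    refine hG.continuousAt.eventually (p := fun L ↦ L.IsInvertible) ?_
    rw [hG0]
    exact h3
  refine ⟨fun i y ↦ D f (extChartAt I x y) ((G (extChartAt I x y)).inverse (b i)),
    fun i ↦ ?_, ?_⟩
  · have h4 : ContDiffAt ℝ ∞ (fun p ↦ D f p ((G p).inverse (b i))) (extChartAt I x x) :=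
      (hD f hf).clm_apply (hGinv.clm_apply contDiffAt_const)
    exact h4.contMDiffAt.comp x contMDiffAt_extChartAt
  · have hf1 : ∀ᶠ y in nhds x, MDifferentiableAt I 𝓘(ℝ, ℝ) f y := by
      have := (contMDiffAt_iff_contMDiffAt_nhds (by simp)).1
        (hf.of_le (m := 1) (by norm_cast))
      filter_upwards [this] with y hy using hy.mdifferentiableAt (by simp)
    filter_upwards [hf1, extChartAt_source_mem_nhds (I := I) x,
      (continuousAt_extChartAt (I := I) x).eventually hGev] with y hy hys hyG
    ext w
    rw [mvfderiv_eq_fderiv_extChartAt hy hys]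
    generalize hu : mfderiv I 𝓘(ℝ, E) (extChartAt I x) y w = u
    have h5 : (G (extChartAt I x y)).inverse (G (extChartAt I x y) u) = u :=
      hyG.inverse_apply_self u
    have h6 : ∀ i, mvfderiv I (F i) y w = D (F i) (extChartAt I x y) u := fun i ↦ by
      rw [mvfderiv_eq_fderiv_extChartAt
        (contMDiff_mdifferentiableAt (hA.smooth _ (hFA i)) y) hys, hu]
    simp only [sum_apply, smul_apply, h6, smul_eq_mul]
    change D f (extChartAt I x y) u = _
    conv_lhs => rw [← h5]
    have h7 : G (extChartAt I x y) u = ∑ i, D (F i) (extChartAt I x y) u • b i :=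
      sum_apply (F := E →L[ℝ] E) _ _ _
    rw [h7]
    simp only [map_sum, map_smul, smul_eq_mul]
    exact Finset.sum_congr rfl fun i _ ↦ mul_comm _ _

/-- A vector field is differentiable as soon as it differentiates the members of a generating set
to differentiable functions. -/
theorem GeneratesCotangent.mdifferentiableAt_field {A : Set (M → ℝ)} (hA : GeneratesCotangent I A)
    {x : M} {X : ∀ y : M, TangentSpace I y}
    (hX : ∀ f ∈ A, MDifferentiableAt I 𝓘(ℝ, ℝ) (fun y ↦ mvfderiv I f y (X y)) x) :
    MDiffAt (T% X) x := by
  rw [mdifferentiableAt_section]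
  obtain ⟨F, hFA, hF⟩ := hA.exists_frame x
  let b := Module.finBasis ℝ E
  have h1 : ∀ i, MDifferentiableAt I 𝓘(ℝ, ℝ)
      (fun y ↦ mvfderiv I (fun z ↦ b.coord i (extChartAt I x z)) y (X y)) x := by
    intro i
    have hs : ContMDiffAt I 𝓘(ℝ, ℝ) ∞ (fun z ↦ b.coord i (extChartAt I x z)) x :=
      (b.coord i).toContinuousLinearMap.contMDiff.contMDiffAt.comp x contMDiffAt_extChartAt
    obtain ⟨c, hc, hce⟩ := hF _ hs
    have h2 : MDifferentiableAt I 𝓘(ℝ, ℝ) (fun y ↦ ∑ i, c i y * mvfderiv I (F i) y (X y)) x := by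
      have h := MDifferentiableAt.sum (t := Finset.univ) fun i _ ↦
        ((hc i).mdifferentiableAt (by simp)).mul (hX _ (hFA i))
      refine h.congr_of_eventuallyEq (Filter.Eventually.of_forall fun y ↦ ?_)
      simp
    refine h2.congr_of_eventuallyEq ?_
    filter_upwards [hce] with y hy
    rw [hy]
    simp
  have h3 : MDifferentiableAt I 𝓘(ℝ, E) (fun y ↦ ∑ i,
      mvfderiv I (fun z ↦ b.coord i (extChartAt I x z)) y (X y) • b i) x := by
    have h := MDifferentiableAt.sum (t := Finset.univ) fun i _ ↦
      (h1 i).smul (mdifferentiableAt_const (c := b i))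
    refine h.congr_of_eventuallyEq (Filter.Eventually.of_forall fun y ↦ ?_)
    simp
  refine h3.congr_of_eventuallyEq ?_
  filter_upwards [(chartAt H x).open_source.mem_nhds (mem_chart_source H x)] with y hy
  have h4 : ∀ i, mvfderiv I (fun z ↦ b.coord i (extChartAt I x z)) y (X y) =
      b.coord i (mfderiv I 𝓘(ℝ, E) (extChartAt I x) y (X y)) := by
    intro i
    have h5 : MDifferentiableAt 𝓘(ℝ, E) 𝓘(ℝ, ℝ) (b.coord i).toContinuousLinearMap
      (extChartAt I x y) := (b.coord i).toContinuousLinearMap.differentiableAt.mdifferentiableAt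
    have h6 := mvfderiv_comp_apply y h5 (mdifferentiableAt_extChartAt (I := I) hy) (X y)
    refine h6.trans ?_
    change mfderiv 𝓘(ℝ, E) 𝓘(ℝ, ℝ) _ _ _ = _
    rw [mfderiv_eq_fderiv, ContinuousLinearMap.fderiv]
    rfl
  simp only [h4]
  have h7 := b.sum_repr (mfderiv I 𝓘(ℝ, E) (extChartAt I x) y (X y))
  refine Eq.trans ?_ h7.symm
  have h8 := congrArg (fun L : E →L[ℝ] E ↦ L (X y))
    (TangentBundle.continuousLinearMapAt_trivializationAt (I := I) hy)
  refine Eq.trans ?_ h8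
  refine (congrFun (Trivialization.coe_linearMapAt_of_mem (R := ℝ)
    (trivializationAt E (TangentSpace I) x) ?_) (X y)).symm
  simpa using hy

/-- A field of antisymmetric maps is smooth as soon as the bracket it defines is smooth on a
generating set. -/
theorem GeneratesCotangent.contMDiff_bivectorBracket {A : Set (M → ℝ)}
    (hA : GeneratesCotangent I A)
    {η : ∀ x : M, (TangentSpace I x →L[ℝ] ℝ) →ₗ[ℝ] TangentSpace I x}
    (hη : ∀ f ∈ A, ∀ g ∈ A, ContMDiff I 𝓘(ℝ, ℝ) ∞ (bivectorBracket η f g))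
    {f g : M → ℝ} (hf : ContMDiff I 𝓘(ℝ, ℝ) ∞ f) (hg : ContMDiff I 𝓘(ℝ, ℝ) ∞ g) :
    ContMDiff I 𝓘(ℝ, ℝ) ∞ (bivectorBracket η f g) := by
  intro x
  obtain ⟨F, hFA, hF⟩ := hA.exists_frame x
  obtain ⟨c, hc, hce⟩ := hF f hf.contMDiffAt
  obtain ⟨d, hd, hde⟩ := hF g hg.contMDiffAt
  have h : ContMDiffAt I 𝓘(ℝ, ℝ) ∞
      (fun y ↦ ∑ j, ∑ i, d j y * (c i y * bivectorBracket η (F i) (F j) y)) x :=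
    contMDiffAt_finsetSum fun j _ ↦ contMDiffAt_finsetSum fun i _ ↦
      (hd j).mul ((hc i).mul (hη _ (hFA i) _ (hFA j)).contMDiffAt)
  refine h.congr_of_eventuallyEq ?_
  filter_upwards [hce, hde] with y hy hy'
  rw [bivectorBracket, hy, hy']
  simp only [map_sum, map_smul, sum_apply, smul_apply, smul_eq_mul, bivectorBracket,
    Finset.mul_sum]
  rw [Finset.sum_comm]
  exact Finset.sum_congr rfl fun _ _ ↦ Finset.sum_congr rfl fun _ _ ↦ by ring

end Frame

section Jacobi

variable {E : Type*} [NormedAddCommGroup E] [NormedSpace ℝ E]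
  {H : Type*} [TopologicalSpace H] {I : ModelWithCorners ℝ E H}
  {M : Type*} [TopologicalSpace M] [ChartedSpace H M]
  {η : ∀ x : M, (TangentSpace I x →L[ℝ] ℝ) →ₗ[ℝ] TangentSpace I x}

theorem bivectorBracket_swap
    (hη : ∀ (x : M) (a b : TangentSpace I x →L[ℝ] ℝ), b (η x a) = -a (η x b)) (f g : M → ℝ) :
    bivectorBracket η f g = -bivectorBracket η g f :=
  funext fun x ↦ hη x _ _

variable [IsManifold I ∞ M] [I.Boundaryless] [FiniteDimensional ℝ E]

/-- The Hamiltonian vector field of a smooth function is differentiable. -/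
theorem GeneratesCotangent.mdifferentiableAt_hamiltonian {A : Set (M → ℝ)}
    (hA : GeneratesCotangent I A)
    (hs : ∀ f g : M → ℝ, ContMDiff I 𝓘(ℝ, ℝ) ∞ f → ContMDiff I 𝓘(ℝ, ℝ) ∞ g →
      ContMDiff I 𝓘(ℝ, ℝ) ∞ (bivectorBracket η f g))
    {f : M → ℝ} (hf : ContMDiff I 𝓘(ℝ, ℝ) ∞ f) (x : M) :
    MDiffAt (T% (fun y : M ↦ η y (mvfderiv I f y))) x :=
  hA.mdifferentiableAt_field fun g hg ↦
    contMDiff_mdifferentiableAt (hs f g hf (hA.smooth g hg)) x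

/-- The Jacobiator of three functions depends only on the differential of the first one. -/
theorem jacobiator_eq_mvfderiv
    (hη : ∀ (x : M) (a b : TangentSpace I x →L[ℝ] ℝ), b (η x a) = -a (η x b))
    {f g h : M → ℝ} (hf : ContMDiff I 𝓘(ℝ, ℝ) ∞ f) {x : M}
    (hg : MDiffAt (T% (fun y : M ↦ η y (mvfderiv I g y))) x)
    (hh : MDiffAt (T% (fun y : M ↦ η y (mvfderiv I h y))) x) :
    bivectorBracket η f (bivectorBracket η g h) x +
      bivectorBracket η g (bivectorBracket η h f) x +
      bivectorBracket η h (bivectorBracket η f g) x =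
    mvfderiv I f x (mlieBracket I (fun y : M ↦ η y (mvfderiv I g y))
      (fun y : M ↦ η y (mvfderiv I h y)) x - η x (mvfderiv I (bivectorBracket η g h) x)) := by
  have h1 : bivectorBracket η h (bivectorBracket η f g) x =
      -mvfderiv I (bivectorBracket η g f) x (η x (mvfderiv I h x)) := by
    rw [bivectorBracket_swap hη f g, bivectorBracket, mvfderiv_neg]
    rfl
  have h2 : bivectorBracket η f (bivectorBracket η g h) x =
      -mvfderiv I f x (η x (mvfderiv I (bivectorBracket η g h) x)) := hη x _ _
  rw [map_sub, mvfderiv_mlieBracket hf hg hh, h1, h2]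
  change _ + mvfderiv I (bivectorBracket η h f) x (η x (mvfderiv I g x)) + _ =
    mvfderiv I (bivectorBracket η h f) x (η x (mvfderiv I g x)) -
      mvfderiv I (bivectorBracket η g f) x (η x (mvfderiv I h x)) - _
  ring

/-- The Jacobi identity holds as soon as it holds on a generating set. -/
theorem GeneratesCotangent.jacobi {A : Set (M → ℝ)} (hA : GeneratesCotangent I A)
    (hη : ∀ (x : M) (a b : TangentSpace I x →L[ℝ] ℝ), b (η x a) = -a (η x b))
    (hs : ∀ f g : M → ℝ, ContMDiff I 𝓘(ℝ, ℝ) ∞ f → ContMDiff I 𝓘(ℝ, ℝ) ∞ g →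
      ContMDiff I 𝓘(ℝ, ℝ) ∞ (bivectorBracket η f g))
    (hJ : ∀ f ∈ A, ∀ g ∈ A, ∀ h ∈ A, ∀ x,
      bivectorBracket η f (bivectorBracket η g h) x +
        bivectorBracket η g (bivectorBracket η h f) x +
        bivectorBracket η h (bivectorBracket η f g) x = 0)
    {f g h : M → ℝ} (hf : ContMDiff I 𝓘(ℝ, ℝ) ∞ f) (hg : ContMDiff I 𝓘(ℝ, ℝ) ∞ g)
    (hh : ContMDiff I 𝓘(ℝ, ℝ) ∞ h) (x : M) :
    bivectorBracket η f (bivectorBracket η g h) x +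
      bivectorBracket η g (bivectorBracket η h f) x +
      bivectorBracket η h (bivectorBracket η f g) x = 0 := by
  let J : (M → ℝ) → (M → ℝ) → (M → ℝ) → ℝ := fun f g h ↦
    bivectorBracket η f (bivectorBracket η g h) x +
      bivectorBracket η g (bivectorBracket η h f) x +
      bivectorBracket η h (bivectorBracket η f g) x
  have cyc : ∀ f g h, J f g h = J g h f := fun f g h ↦ by simp only [J]; ring
  have repl : ∀ f f' g h, ContMDiff I 𝓘(ℝ, ℝ) ∞ f → ContMDiff I 𝓘(ℝ, ℝ) ∞ f' →
      ContMDiff I 𝓘(ℝ, ℝ) ∞ g → ContMDiff I 𝓘(ℝ, ℝ) ∞ h →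
      mvfderiv I f x = mvfderiv I f' x → J f g h = J f' g h := by
    intro f f' g h hf hf' hg hh hff
    have hg' := hA.mdifferentiableAt_hamiltonian hs hg x
    have hh' := hA.mdifferentiableAt_hamiltonian hs hh x
    simp only [J]
    rw [jacobiator_eq_mvfderiv hη hf hg' hh', jacobiator_eq_mvfderiv hη hf' hg' hh', hff]
  obtain ⟨F, hF, hFx⟩ := hA.exists_eq x (mvfderiv I f x)
  obtain ⟨G, hG, hGx⟩ := hA.exists_eq x (mvfderiv I g x)
  obtain ⟨K, hK, hKx⟩ := hA.exists_eq x (mvfderiv I h x)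
  have hF' := hA.smooth F hF
  have hG' := hA.smooth G hG
  have hK' := hA.smooth K hK
  change J f g h = 0
  rw [repl f F g h hf hF' hg hh hFx.symm, cyc, repl g G h F hg hG' hh hF' hGx.symm, cyc,
    repl h K F G hh hK' hF' hG' hKx.symm, cyc]
  exact hJ F hF G hG K hK x

end Jacobi

section Forms

variable {E : Type*} [NormedAddCommGroup E] [NormedSpace ℝ E]
  {H : Type*} [TopologicalSpace H] {I : ModelWithCorners ℝ E H}
  {M : Type*} [TopologicalSpace M] [ChartedSpace H M]

theorem tangent_eq_of_forall_covector {x : M} {u w : TangentSpace I x}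
    (h : ∀ a : TangentSpace I x →L[ℝ] ℝ, a u = a w) : u = w := by
  exact (SeparatingDual.eq_iff_forall_dual_eq (R := ℝ) (V := E) (x := u) (y := w)).2 h

variable [IsManifold I ∞ M]

theorem IsSmoothForm.diffFormAt {α : ∀ x : M, Cotangent I x} (hα : IsSmoothForm α) (x : M) :
    DiffFormAt α x :=
  hα.mdifferentiableAt (by simp)

theorem IsSmoothForm.contMDiff_formFun {α : ∀ x : M, Cotangent I x} (hα : IsSmoothForm α) :
    ContMDiff I.tangent 𝓘(ℝ, ℝ) ∞ (formFun α) := by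
  have h := ContMDiff.clm_bundle_apply (IM := I.tangent) (M := TangentBundle I M) (IB := I)
    (b := fun v : TangentBundle I M ↦ v.proj)
    (E₁ := TangentSpace I) (E₂ := Bundle.Trivial M ℝ) (F₁ := E) (F₂ := ℝ) (n := ∞)
    (ϕ := fun v ↦ α v.proj) (v := fun v ↦ v.2)
    (hα.comp (contMDiff_proj (TangentSpace I))) contMDiff_id
  exact fun v ↦ (contMDiffAt_totalSpace.1 (h v)).2

theorem isSmoothForm_mvfderiv {f : M → ℝ} (hf : ContMDiff I 𝓘(ℝ, ℝ) ∞ f) :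
    IsSmoothForm (I := I) (fun x ↦ mvfderiv I f x) := by
  intro x
  refine (contMDiffAt_hom_bundle _).2 ⟨contMDiffAt_id, ?_⟩
  have h := ContMDiffAt.mfderiv_const (m := ∞) (hf x) (by simp)
  refine h.congr_of_eventuallyEq (Filter.Eventually.of_forall fun y ↦ ?_)
  ext u
  simp only [mvfderiv, ContinuousLinearMap.inCoordinates, inTangentCoordinates,
    ContinuousLinearMap.comp_apply]
  simp
  rfl

theorem isClosedForm_mvfderiv [I.Boundaryless] [CompleteSpace E] {f : M → ℝ}
    (hf : ContMDiff I 𝓘(ℝ, ℝ) ∞ f) : IsClosedForm (I := I) (fun x ↦ mvfderiv I f x) := by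
  intro x X Y hX hY
  have := mvfderiv_mlieBracket hf hX hY
  linarith

theorem contMDiff_fiberInclusion (x : M) :
    ContMDiff 𝓘(ℝ, E) I.tangent ∞ (fun w : E ↦ (⟨x, w⟩ : TangentBundle I M)) := by
  intro w
  refine contMDiffAt_totalSpace.2 ⟨contMDiffAt_const, ?_⟩
  have h : (fun w : E ↦ ((trivializationAt E (TangentSpace I) x) (⟨x, w⟩ : TangentBundle I M)).2) =
      (trivializationAt E (TangentSpace I) x).continuousLinearMapAt ℝ x := by
    ext w
    exact (congrFun (Trivialization.coe_linearMapAt_of_mem (R := ℝ)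
      (trivializationAt E (TangentSpace I) x) (FiberBundle.mem_baseSet_trivializationAt' x)) w).symm
  change ContMDiffAt 𝓘(ℝ, E) 𝓘(ℝ, E) ∞
    (fun w : E ↦ ((trivializationAt E (TangentSpace I) x) (⟨x, w⟩ : TangentBundle I M)).2) w
  rw [h]
  exact ContinuousLinearMap.contMDiff (E := E) (F := E)
    ((trivializationAt E (TangentSpace I) x).continuousLinearMapAt ℝ x) w

theorem mvfderiv_verticalLift {F : TangentBundle I M → ℝ} {v : TangentBundle I M}
    (hF : MDifferentiableAt I.tangent 𝓘(ℝ, ℝ) F v) (u : TangentSpace I v.proj) :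
    mvfderiv I.tangent F v (verticalLift v u) =
      fderiv ℝ (fun w : E ↦ F ⟨v.proj, w⟩) v.2 u := by
  have h := mvfderiv_comp_apply (I := I.tangent) (I' := 𝓘(ℝ, E))
    (f := fun w : E ↦ (⟨v.proj, w⟩ : TangentBundle I M)) (g := F) (v.2 : E) hF
    ((contMDiff_fiberInclusion v.proj).mdifferentiable (by simp) _) u
  exact h.symm.trans (congrArg (fun L : E →L[ℝ] ℝ ↦ L u)
    (mfderiv_eq_fderiv (f := fun w : E ↦ F ⟨v.proj, w⟩) (x := (v.2 : E))))

theorem dVert_formFun {α : ∀ x : M, Cotangent I x} (hα : IsSmoothForm α)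
    (v : TangentBundle I M) : dVert (formFun α) v = α v.proj := by
  ext u
  refine (mvfderiv_verticalLift (contMDiff_mdifferentiableAt hα.contMDiff_formFun v) u).trans ?_
  exact congrArg (fun L : E →L[ℝ] ℝ ↦ L u) (ContinuousLinearMap.fderiv (α v.proj : E →L[ℝ] ℝ))

theorem contMDiff_comp_proj {f : M → ℝ} (hf : ContMDiff I 𝓘(ℝ, ℝ) ∞ f) :
    ContMDiff I.tangent 𝓘(ℝ, ℝ) ∞ (fun w : TangentBundle I M ↦ f w.proj) :=
  hf.comp (contMDiff_proj (TangentSpace I))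

theorem dVert_comp_proj {f : M → ℝ} (hf : ContMDiff I 𝓘(ℝ, ℝ) ∞ f)
    (v : TangentBundle I M) : dVert (fun w : TangentBundle I M ↦ f w.proj) v = 0 := by
  ext u
  refine (mvfderiv_verticalLift (contMDiff_mdifferentiableAt (contMDiff_comp_proj hf) v) u).trans ?_
  exact congrArg (fun L : E →L[ℝ] ℝ ↦ L u) (fderiv_const_apply (x := (v.2 : E)) (f v.proj))

theorem mvfderiv_fieldDeriv {F : TangentBundle I M → ℝ} {v : TangentBundle I M}
    (hF : MDifferentiableAt I.tangent 𝓘(ℝ, ℝ) F v) {X : ∀ y : M, TangentSpace I y}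
    (h : X v.proj = v.2) (hX : MDiffAt (T% X) v.proj) (u : TangentSpace I v.proj) :
    mvfderiv I.tangent F v (fieldDeriv X v h u) =
      mvfderiv I (fun y : M ↦ F ⟨y, X y⟩) v.proj u := by
  obtain ⟨x, w⟩ := v
  dsimp only at h
  subst h
  exact (mvfderiv_comp_apply (I := I.tangent) (I' := I)
    (f := fun y : M ↦ (⟨y, X y⟩ : TangentBundle I M)) (g := F) x hF hX u).symm

variable (cov : CovariantDerivative I E (TangentSpace I : M → Type _))

theorem dHor_apply {F : TangentBundle I M → ℝ} {v : TangentBundle I M}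
    (hF : MDifferentiableAt I.tangent 𝓘(ℝ, ℝ) F v) (u : TangentSpace I v.proj) :
    dHor cov F v u = mvfderiv I (fun y : M ↦ F ⟨y, extend E v.2 y⟩) v.proj u -
      dVert F v (cov (extend E v.2) v.proj u) := by
  refine (map_sub (mvfderiv I.tangent F v) (fieldDeriv _ _ _ u) _).trans ?_
  rw [mvfderiv_fieldDeriv hF _ (mdifferentiableAt_extend I E v.2)]
  rfl

theorem dHor_comp_proj {f : M → ℝ} (hf : ContMDiff I 𝓘(ℝ, ℝ) ∞ f)
    (v : TangentBundle I M) :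
    dHor cov (fun w : TangentBundle I M ↦ f w.proj) v = mvfderiv I f v.proj := by
  ext u
  rw [dHor_apply cov (contMDiff_mdifferentiableAt (contMDiff_comp_proj hf) v), dVert_comp_proj hf]
  simp

theorem mvfderiv_lift_add_lift (F : TangentBundle I M → ℝ) (v : TangentBundle I M)
    (p q : TangentSpace I v.proj) :
    mvfderiv I.tangent F v (verticalLift v p + horizontalLift cov v q) =
      dVert F v p + dHor cov F v q :=
  map_add _ _ _

theorem dHor_formFun [FiniteDimensional ℝ E] {α : ∀ x : M, Cotangent I x} (hα : IsSmoothForm α)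
    (v : TangentBundle I M) (u : TangentSpace I v.proj) :
    dHor cov (formFun α) v u = covDerivForm cov α (hα.diffFormAt v.proj) u v.2 := by
  rw [dHor_apply cov (contMDiff_mdifferentiableAt hα.contMDiff_formFun v), dVert_formFun hα]
  have h := covDerivForm_apply cov (hα.diffFormAt v.proj) u (mdifferentiableAt_extend I E v.2)
  rw [extend_apply_self] at h
  rw [h]
  rfl

end Forms

section Splitting

variable {E : Type*} [NormedAddCommGroup E] [NormedSpace ℝ E] [FiniteDimensional ℝ E]
  {H : Type*} [TopologicalSpace H] {I : ModelWithCorners ℝ E H}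
  {M : Type*} [TopologicalSpace M] [ChartedSpace H M] [IsManifold I ∞ M]

variable [T2Space M] (cov : CovariantDerivative I E (TangentSpace I : M → Type _))

theorem eq_zero_of_lift_add_lift_eq_zero {v : TangentBundle I M} {p q : TangentSpace I v.proj}
    (h : verticalLift v p + horizontalLift cov v q = 0) : p = 0 ∧ q = 0 := by
  have h2 : ∀ F : TangentBundle I M → ℝ, dVert F v p + dHor cov F v q = 0 := fun F ↦ by
    rw [← mvfderiv_lift_add_lift, h, map_zero]
  have hq : q = 0 := by
    refine tangent_eq_of_forall_covector fun a ↦ ?_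
    obtain ⟨f, hf, hfa⟩ := exists_contMDiff_mvfderiv_eq v.proj a
    have := h2 (fun w ↦ f w.proj)
    rw [dVert_comp_proj hf, dHor_comp_proj cov hf, hfa] at this
    simpa using this
  refine ⟨tangent_eq_of_forall_covector fun a ↦ ?_, hq⟩
  obtain ⟨f, hf, hfa⟩ := exists_contMDiff_mvfderiv_eq v.proj a
  have := h2 (formFun fun x ↦ mvfderiv I f x)
  rw [dVert_formFun (isSmoothForm_mvfderiv hf), hfa, hq] at this
  simpa using this

/-- The tangent spaces of the tangent bundle are spanned by vertical and horizontal lifts. -/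
theorem exists_eq_verticalLift_add_horizontalLift (v : TangentBundle I M)
    (w : TangentSpace I.tangent v) :
    ∃ p q : TangentSpace I v.proj, w = verticalLift v p + horizontalLift cov v q := by
  let T : E × E →ₗ[ℝ] E × E :=
    LinearMap.coprod (M := E) (M₂ := E) (M₃ := E × E)
      (verticalLift v).toLinearMap (horizontalLift cov v).toLinearMap
  have hT : Function.Injective T := by
    rw [injective_iff_map_eq_zero]
    rintro ⟨p, q⟩ h
    have h1 := eq_zero_of_lift_add_lift_eq_zero cov (p := p) (q := q)
      ((LinearMap.coprod_apply _ _ _).symm.trans h)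
    exact Prod.ext h1.1 h1.2
  obtain ⟨⟨p, q⟩, hpq⟩ := LinearMap.injective_iff_surjective.1 hT w
  exact ⟨p, q, hpq.symm.trans (LinearMap.coprod_apply _ _ _)⟩

theorem covector_eq_of_comp_lift_eq {v : TangentBundle I M}
    {a b : TangentSpace I.tangent v →L[ℝ] ℝ}
    (hV : a ∘L verticalLift v = b ∘L verticalLift v)
    (hH : a ∘L horizontalLift cov v = b ∘L horizontalLift cov v) : a = b := by
  ext w
  obtain ⟨p, q, rfl⟩ := exists_eq_verticalLift_add_horizontalLift cov v w
  rw [map_add, map_add]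
  exact congrArg₂ (· + ·) (congrArg (fun L : TangentSpace I v.proj →L[ℝ] ℝ ↦ L p) hV)
    (congrArg (fun L : TangentSpace I v.proj →L[ℝ] ℝ ↦ L q) hH)

end Splitting

section TangentLift

variable {E : Type*} [NormedAddCommGroup E] [NormedSpace ℝ E]
  {H : Type*} [TopologicalSpace H] {I : ModelWithCorners ℝ E H}
  {M : Type*} [TopologicalSpace M] [ChartedSpace H M] [IsManifold I ∞ M]

variable (I) in
/-- The function `v ↦ df(v) + h(p v)` on the tangent bundle. -/
def tangentLift (f h : M → ℝ) : TangentBundle I M → ℝ :=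
  formFun (fun x ↦ mvfderiv I f x) + fun v ↦ h v.proj

theorem contMDiff_tangentLift {f h : M → ℝ} (hf : ContMDiff I 𝓘(ℝ, ℝ) ∞ f)
    (hh : ContMDiff I 𝓘(ℝ, ℝ) ∞ h) : ContMDiff I.tangent 𝓘(ℝ, ℝ) ∞ (tangentLift I f h) :=
  (isSmoothForm_mvfderiv hf).contMDiff_formFun.add (contMDiff_comp_proj hh)

theorem mvfderiv_tangentLift {f h : M → ℝ} (hf : ContMDiff I 𝓘(ℝ, ℝ) ∞ f)
    (hh : ContMDiff I 𝓘(ℝ, ℝ) ∞ h) (v : TangentBundle I M) :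
    mvfderiv I.tangent (tangentLift I f h) v =
      mvfderiv I.tangent (formFun fun x ↦ mvfderiv I f x) v +
        mvfderiv I.tangent (fun w : TangentBundle I M ↦ h w.proj) v :=
  mvfderiv_add (contMDiff_mdifferentiableAt (isSmoothForm_mvfderiv hf).contMDiff_formFun v)
    (contMDiff_mdifferentiableAt (contMDiff_comp_proj hh) v)

variable (I M) in
/-- The functions `v ↦ df(v) + h(p v)` on the tangent bundle, `f` and `h` being smooth. -/
def tangentLifts : Set (TangentBundle I M → ℝ) :=
  {F | ∃ f h : M → ℝ, ContMDiff I 𝓘(ℝ, ℝ) ∞ f ∧ ContMDiff I 𝓘(ℝ, ℝ) ∞ h ∧ tangentLift I f h = F}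

theorem generatesCotangent_tangentLifts [FiniteDimensional ℝ E] [T2Space M]
    (cov : CovariantDerivative I E (TangentSpace I : M → Type _)) :
    GeneratesCotangent I.tangent (tangentLifts I M) where
  smooth := by
    rintro F ⟨f, h, hf, hh, rfl⟩
    exact contMDiff_tangentLift hf hh
  exists_eq := by
    intro v a
    obtain ⟨f, hf, hfa⟩ := exists_contMDiff_mvfderiv_eq v.proj (a ∘L verticalLift v)
    obtain ⟨h, hh, hha⟩ := exists_contMDiff_mvfderiv_eq v.proj
      (a ∘L horizontalLift cov v - dHor cov (formFun fun x ↦ mvfderiv I f x) v)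
    refine ⟨_, ⟨f, h, hf, hh, rfl⟩, ?_⟩
    rw [mvfderiv_tangentLift hf hh]
    refine covector_eq_of_comp_lift_eq cov ?_ ?_
    · rw [ContinuousLinearMap.add_comp]
      change dVert _ v + dVert _ v = _
      rw [dVert_formFun (isSmoothForm_mvfderiv hf), dVert_comp_proj hh, ← hfa]
      exact add_zero _
    · rw [ContinuousLinearMap.add_comp]
      change dHor cov _ v + dHor cov _ v = _
      rw [dHor_comp_proj cov hh, hha]
      exact add_sub_cancel _ _

end TangentLift

section VertDeriv

variable {E : Type*} [NormedAddCommGroup E] [NormedSpace ℝ E]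
  {H : Type*} [TopologicalSpace H] {I : ModelWithCorners ℝ E H}
  {M : Type*} [TopologicalSpace M] [ChartedSpace H M]
  (η : PoissonStructure I M)

theorem PoissonStructure.bivector_swap (x : M) (a b : TangentSpace I x →L[ℝ] ℝ) :
    η.bivector x a b = -η.bivector x b a :=
  η.antisymm x a b

variable [FiniteDimensional ℝ E] [IsManifold I ∞ M]
  (cov : CovariantDerivative I E (TangentSpace I : M → Type _))

/-- For a torsion-free connection, the covariant derivative of a closed form is symmetric. -/
theorem covDerivForm_symm (htorsion : cov.torsion = 0) {α : ∀ x : M, Cotangent I x}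
    (hc : IsClosedForm α) {x : M} (hα : DiffFormAt α x) (u w : TangentSpace I x) :
    covDerivForm cov α hα u w = covDerivForm cov α hα w u := by
  have hU := mdifferentiableAt_extend I E u
  have hW := mdifferentiableAt_extend I E w
  have h1 := covDerivForm_apply cov hα u hW
  have h2 := covDerivForm_apply cov hα w hU
  have h3 := (CovariantDerivative.torsion_eq_zero_iff cov).1 htorsion hU hW
  have h4 := hc x _ _ hU hW
  rw [← h3] at h4
  have h5 : (α x (cov (extend E w) x (extend E u x) - cov (extend E u) x (extend E w x)) : ℝ) =
    α x (cov (extend E w) x (extend E u x)) - α x (cov (extend E u) x (extend E w x)) :=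
      map_sub (α x) _ _
  rw [h5] at h4
  simp only [extend_apply_self] at h1 h2 h4
  rw [h1, h2]
  linarith

/-- The covariant derivative of the bivector field in the direction of `u`, evaluated at two
`1`-forms. -/
def PoissonStructure.covDeriv {α β : ∀ x : M, Cotangent I x} {x : M} (hα : DiffFormAt α x)
    (hβ : DiffFormAt β x) (u : TangentSpace I x) : ℝ :=
  mvfderiv I (fun y ↦ η.bivector y (α y) (β y)) x u
    - η.bivector x (covDerivForm cov α hα u) (β x)
    - η.bivector x (α x) (covDerivForm cov β hβ u)

theorem PoissonStructure.covDeriv_swap {α β : ∀ x : M, Cotangent I x} {x : M}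
    (hα : DiffFormAt α x) (hβ : DiffFormAt β x) (u : TangentSpace I x) :
    η.covDeriv cov hα hβ u = -η.covDeriv cov hβ hα u := by
  have h : (fun y ↦ η.bivector y (α y) (β y)) = -fun y ↦ η.bivector y (β y) (α y) :=
    funext fun y ↦ η.bivector_swap y _ _
  rw [covDeriv, covDeriv, h, mvfderiv_neg, η.bivector_swap x (α x),
    η.bivector_swap x (covDerivForm cov α hα u)]
  simp only [neg_apply]
  ring

variable [T2Space M]

variable (I M) in
theorem generatesCotangent_contMDiff :
    GeneratesCotangent I {f : M → ℝ | ContMDiff I 𝓘(ℝ, ℝ) ∞ f} where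
  smooth _ hf := hf
  exists_eq x a := exists_contMDiff_mvfderiv_eq x a

variable [I.Boundaryless]

theorem PoissonStructure.mdifferentiableAt_sharp {α : ∀ x : M, Cotangent I x} {x : M}
    (hα : DiffFormAt α x) : MDiffAt (T% (fun y : M ↦ η.sharp y (α y))) x := by
  refine (generatesCotangent_contMDiff I M).mdifferentiableAt_field fun f hf ↦ ?_
  have h : (fun y ↦ mvfderiv I f y (η.sharp y (α y))) =
      fun y ↦ -(α y (η.sharp y (mvfderiv I f y)) : ℝ) := funext fun y ↦ η.antisymm y _ _
  rw [h]
  exact (hα.apply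
    ((generatesCotangent_contMDiff I M).mdifferentiableAt_hamiltonian η.smooth hf x)).neg

theorem PoissonStructure.covDeriv_eq {α β : ∀ x : M, Cotangent I x} {x : M}
    (hα : DiffFormAt α x) (hβ : DiffFormAt β x) (u : TangentSpace I x) :
    η.covDeriv cov hα hβ u = (β x (cov (fun y ↦ η.sharp y (α y)) x u -
      η.sharp x (covDerivForm cov α hα u)) : ℝ) := by
  have h := covDerivForm_apply cov hβ u (η.mdifferentiableAt_sharp hα)
  have h2 : (β x (cov (fun y ↦ η.sharp y (α y)) x u -
      η.sharp x (covDerivForm cov α hα u)) : ℝ) = β x (cov (fun y ↦ η.sharp y (α y)) x u) -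
        β x (η.sharp x (covDerivForm cov α hα u)) := map_sub (β x) _ _
  rw [h2]
  simp only [covDeriv, bivector]
  rw [h]
  ring

theorem PoissonStructure.vertDeriv_eq_covDeriv {α β : ∀ x : M, Cotangent I x}
    (v : TangentBundle I M) (hα : DiffFormAt α v.proj) (hβ : DiffFormAt β v.proj) :
    η.vertDeriv cov v (α v.proj) (β v.proj) = η.covDeriv cov hα hβ v.2 := by
  have key : ∀ {α β β' : ∀ x : M, Cotangent I x} {x : M} (hα : DiffFormAt α x)
      (hβ : DiffFormAt β x) (hβ' : DiffFormAt β' x) (u : TangentSpace I x), β x = β' x →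
      η.covDeriv cov hα hβ u = η.covDeriv cov hα hβ' u := by
    intro α β β' x hα hβ hβ' u h
    rw [η.covDeriv_eq cov, η.covDeriv_eq cov, h]
  have hα' := diffFormAt_extend (α v.proj)
  have hβ' := diffFormAt_extend (β v.proj)
  have h : η.vertDeriv cov v (α v.proj) (β v.proj) = η.covDeriv cov hα' hβ' v.2 := by
    simp only [vertDeriv, covDeriv, extend_apply_self]
  rw [h, key hα' hβ' hβ v.2 (extend_apply_self _ _), η.covDeriv_swap cov hα' hβ,
    key hβ hα' hα v.2 (extend_apply_self _ _), ← η.covDeriv_swap cov hα hβ]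

theorem PoissonStructure.vertDeriv_swap (v : TangentBundle I M)
    (a b : TangentSpace I v.proj →L[ℝ] ℝ) :
    η.vertDeriv cov v a b = -η.vertDeriv cov v b a := by
  have h := η.covDeriv_swap cov (diffFormAt_extend (I := I) a) (diffFormAt_extend (I := I) b) v.2
  rw [← η.vertDeriv_eq_covDeriv, ← η.vertDeriv_eq_covDeriv] at h
  simpa only [extend_apply_self] using h

theorem PoissonStructure.exists_vertDeriv_eq (v : TangentBundle I M)
    (a : TangentSpace I v.proj →L[ℝ] ℝ) :
    ∃ w : TangentSpace I v.proj, ∀ b, η.vertDeriv cov v a b = b w := by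
  refine ⟨cov (fun y ↦ η.sharp y (extend (E := Cotangent I) (E →L[ℝ] ℝ) (x := v.proj) a y))
    v.proj v.2 - η.sharp v.proj (covDerivForm cov _ (diffFormAt_extend a) v.2), fun b ↦ ?_⟩
  have h := η.covDeriv_eq cov (diffFormAt_extend (I := I) a) (diffFormAt_extend (I := I) b) v.2
  rw [← η.vertDeriv_eq_covDeriv] at h
  simp only [extend_apply_self] at h
  exact h

/-- The bivector `𝔇η(v)` as an antisymmetric map `T*_x M → T_x M`. -/
def PoissonStructure.vertDerivSharp (v : TangentBundle I M) :
    (TangentSpace I v.proj →L[ℝ] ℝ) →ₗ[ℝ] TangentSpace I v.proj where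
  toFun a := (η.exists_vertDeriv_eq cov v a).choose
  map_add' a a' := tangent_eq_of_forall_covector fun b ↦ by
    have h (c : TangentSpace I v.proj →L[ℝ] ℝ) := (η.exists_vertDeriv_eq cov v c).choose_spec
    rw [map_add, ← h, ← h, ← h, η.vertDeriv_swap, h b, η.vertDeriv_swap cov v a, h b,
      η.vertDeriv_swap cov v a', h b, add_apply]
    ring
  map_smul' r a := tangent_eq_of_forall_covector fun b ↦ by
    have h (c : TangentSpace I v.proj →L[ℝ] ℝ) := (η.exists_vertDeriv_eq cov v c).choose_spec
    rw [RingHom.id_apply, map_smul, ← h, ← h, η.vertDeriv_swap, h b, η.vertDeriv_swap cov v a, h b,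
      smul_apply]
    simp

theorem PoissonStructure.apply_vertDerivSharp (v : TangentBundle I M)
    (a b : TangentSpace I v.proj →L[ℝ] ℝ) :
    b (η.vertDerivSharp cov v a) = η.vertDeriv cov v a b :=
  ((η.exists_vertDeriv_eq cov v a).choose_spec b).symm

/-- The bracket of closed forms, on a vector, is the derivative of their pairing. -/
theorem PoissonStructure.formBracket_eq_mvfderiv {α β : ∀ x : M, Cotangent I x}
    (hα : IsSmoothForm α) (hαc : IsClosedForm α) (hβ : IsSmoothForm β) (hβc : IsClosedForm β)
    (x : M) (v : TangentSpace I x) :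
    η.formBracket α β x v = mvfderiv I (fun y ↦ η.bivector y (α y) (β y)) x v := by
  have key : ∀ {X : ∀ y : M, TangentSpace I y} {γ : ∀ x : M, Cotangent I x}, IsClosedForm γ →
      MDiffAt (T% X) x → lieDerivForm X γ x v = mvfderiv I (fun y ↦ (γ y (X y) : ℝ)) x v := by
    intro X γ hγ hX
    have h := hγ x X _ hX (mdifferentiableAt_extend I E v)
    rw [extend_apply_self] at h
    rw [lieDerivForm]
    linarith
  have h : (fun y ↦ (α y (η.sharp y (β y)) : ℝ)) = -fun y ↦ η.bivector y (α y) (β y) :=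
    funext fun y ↦ η.antisymm y _ _
  rw [formBracket, key hβc (η.mdifferentiableAt_sharp (hα.diffFormAt x)),
    key hαc (η.mdifferentiableAt_sharp (hβ.diffFormAt x)), h, mvfderiv_neg]
  simp only [bivector, neg_apply]
  ring

end VertDeriv

section LiePoisson

variable {E : Type*} [NormedAddCommGroup E] [NormedSpace ℝ E]
  {H : Type*} [TopologicalSpace H] {I : ModelWithCorners ℝ E H}
  {M : Type*} [TopologicalSpace M] [ChartedSpace H M]

theorem bivectorBracket_add_add
    {σ : ∀ x : M, (TangentSpace I x →L[ℝ] ℝ) →ₗ[ℝ] TangentSpace I x} {F F₁ F₂ G G₁ G₂ : M → ℝ}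
    {x : M} (hF : mvfderiv I F x = mvfderiv I F₁ x + mvfderiv I F₂ x)
    (hG : mvfderiv I G x = mvfderiv I G₁ x + mvfderiv I G₂ x) :
    bivectorBracket σ F G x = bivectorBracket σ F₁ G₁ x + bivectorBracket σ F₁ G₂ x +
      bivectorBracket σ F₂ G₁ x + bivectorBracket σ F₂ G₂ x := by
  simp only [bivectorBracket, hF, hG, map_add, add_apply]
  ring

theorem PoissonStructure.contMDiff_bracket (η : PoissonStructure I M) {f g : M → ℝ} (hf : ContMDiff I 𝓘(ℝ, ℝ) ∞ f)
    (hg : ContMDiff I 𝓘(ℝ, ℝ) ∞ g) : ContMDiff I 𝓘(ℝ, ℝ) ∞ (η.bracket f g) :=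
  η.smooth f g hf hg

theorem PoissonStructure.bracket_add (η : PoissonStructure I M) {f g k : M → ℝ} (hg : ContMDiff I 𝓘(ℝ, ℝ) ∞ g)
    (hk : ContMDiff I 𝓘(ℝ, ℝ) ∞ k) : η.bracket f (g + k) = η.bracket f g + η.bracket f k := by
  funext x
  change mvfderiv I (g + k) x _ = _
  rw [mvfderiv_add (contMDiff_mdifferentiableAt hg x) (contMDiff_mdifferentiableAt hk x)]
  rfl

theorem tangentLift_add {f h g k : M → ℝ} (hf : ContMDiff I 𝓘(ℝ, ℝ) ∞ f)
    (hg : ContMDiff I 𝓘(ℝ, ℝ) ∞ g) :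
    tangentLift I f h + tangentLift I g k = tangentLift I (f + g) (h + k) := by
  funext v
  change mvfderiv I f v.proj v.2 + h v.proj + (mvfderiv I g v.proj v.2 + k v.proj) =
    mvfderiv I (f + g) v.proj v.2 + (h v.proj + k v.proj)
  rw [mvfderiv_add (contMDiff_mdifferentiableAt hf _) (contMDiff_mdifferentiableAt hg _), add_apply]
  ring

variable [IsManifold I ∞ M]

/-- The bracket of two functions `v ↦ df(v) + h(p v)` for a bivector field on the tangent bundle
that has the values of the Lie–Poisson structure on generators. -/
theorem bivectorBracket_tangentLift {η : PoissonStructure I M}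
    {σ : ∀ v : TangentBundle I M,
      (TangentSpace I.tangent v →L[ℝ] ℝ) →ₗ[ℝ] TangentSpace I.tangent v}
    (hσ : ∀ (v : TangentBundle I M) (a b : TangentSpace I.tangent v →L[ℝ] ℝ),
      b (σ v a) = -a (σ v b))
    {f h g k : M → ℝ} (hf : ContMDiff I 𝓘(ℝ, ℝ) ∞ f) (hh : ContMDiff I 𝓘(ℝ, ℝ) ∞ h)
    (hg : ContMDiff I 𝓘(ℝ, ℝ) ∞ g) (hk : ContMDiff I 𝓘(ℝ, ℝ) ∞ k) {v : TangentBundle I M}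
    (h1 : bivectorBracket σ (formFun fun x ↦ mvfderiv I f x) (formFun fun x ↦ mvfderiv I g x) v =
      mvfderiv I (η.bracket f g) v.proj v.2)
    (h2 : bivectorBracket σ (formFun fun x ↦ mvfderiv I f x) (fun w ↦ k w.proj) v =
      η.bracket f k v.proj)
    (h3 : bivectorBracket σ (formFun fun x ↦ mvfderiv I g x) (fun w ↦ h w.proj) v =
      η.bracket g h v.proj)
    (h4 : bivectorBracket σ (fun w : TangentBundle I M ↦ h w.proj) (fun w ↦ k w.proj) v = 0) :
    bivectorBracket σ (tangentLift I f h) (tangentLift I g k) v =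
      tangentLift I (η.bracket f g) (η.bracket f k + η.bracket h g) v := by
  rw [bivectorBracket_add_add (mvfderiv_tangentLift hf hh v) (mvfderiv_tangentLift hg hk v), h1, h2,
    h4, bivectorBracket_swap hσ (fun w : TangentBundle I M ↦ h w.proj), Pi.neg_apply, h3]
  have h5 : η.bracket h g v.proj = -η.bracket g h v.proj := η.antisymm _ _ _
  change _ = mvfderiv I (η.bracket f g) v.proj v.2 + (η.bracket f k v.proj + η.bracket h g v.proj)
  rw [h5]
  ring

variable [FiniteDimensional ℝ E] [T2Space M] [I.Boundaryless]

theorem IsLiePoisson.bracket_tangentLift {η : PoissonStructure I M}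
    {θ : PoissonStructure I.tangent (TangentBundle I M)} (hθ : IsLiePoisson η θ)
    {f h g k : M → ℝ} (hf : ContMDiff I 𝓘(ℝ, ℝ) ∞ f) (hh : ContMDiff I 𝓘(ℝ, ℝ) ∞ h)
    (hg : ContMDiff I 𝓘(ℝ, ℝ) ∞ g) (hk : ContMDiff I 𝓘(ℝ, ℝ) ∞ k) (v : TangentBundle I M) :
    θ.bracket (tangentLift I f h) (tangentLift I g k) v =
      tangentLift I (η.bracket f g) (η.bracket f k + η.bracket h g) v := by
  have hf' := isSmoothForm_mvfderiv hf
  have hg' := isSmoothForm_mvfderiv hg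
  have hfc := isClosedForm_mvfderiv hf
  have hgc := isClosedForm_mvfderiv hg
  refine bivectorBracket_tangentLift θ.antisymm hf hh hg hk ?_ (hθ.form_fun _ _ hf' hfc hk v)
    (hθ.form_fun _ _ hg' hgc hh v) (hθ.fun_fun h k hh hk v)
  exact (hθ.form_form _ _ hf' hfc hg' hgc v).trans
    (η.formBracket_eq_mvfderiv hf' hfc hg' hgc _ _)

/-- There is at most one Lie–Poisson structure on the tangent bundle. -/
theorem IsLiePoisson.unique (cov : CovariantDerivative I E (TangentSpace I : M → Type _))
    {η : PoissonStructure I M} {θ θ' : PoissonStructure I.tangent (TangentBundle I M)}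
    (hθ : IsLiePoisson η θ) (hθ' : IsLiePoisson η θ') : θ = θ' := by
  have hA := generatesCotangent_tangentLifts (I := I) (M := M) cov
  ext v : 2
  refine LinearMap.ext fun a ↦ tangent_eq_of_forall_covector fun b ↦ ?_
  obtain ⟨_, ⟨f, h, hf, hh, rfl⟩, rfl⟩ := hA.exists_eq v a
  obtain ⟨_, ⟨g, k, hg, hk, rfl⟩, rfl⟩ := hA.exists_eq v b
  exact (hθ.bracket_tangentLift hf hh hg hk v).trans
    (hθ'.bracket_tangentLift hf hh hg hk v).symm

variable (η : PoissonStructure I M)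
  (cov : CovariantDerivative I E (TangentSpace I : M → Type _))

/-- The bivector field on the tangent bundle which is given, in the splitting of a connection, by
`⟨𝔇η, ∂₁ ∧ ∂₁⟩ + ⟨η, ∂₁ ∧ ∂₂⟩ - ⟨η, ∂₂ ∧ ∂₁⟩`. -/
def PoissonStructure.tangentSharp (v : TangentBundle I M) :
    (TangentSpace I.tangent v →L[ℝ] ℝ) →ₗ[ℝ] TangentSpace I.tangent v where
  toFun a := verticalLift v (η.vertDerivSharp cov v (a ∘L verticalLift v) +
      η.sharp v.proj (a ∘L horizontalLift cov v)) +
    horizontalLift cov v (η.sharp v.proj (a ∘L verticalLift v))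
  map_add' a b := by
    simp only [ContinuousLinearMap.add_comp, map_add]
    abel
  map_smul' r a := by
    simp only [ContinuousLinearMap.smul_comp, map_smul, ← smul_add, RingHom.id_apply]

theorem PoissonStructure.apply_tangentSharp (v : TangentBundle I M)
    (a b : TangentSpace I.tangent v →L[ℝ] ℝ) :
    b (η.tangentSharp cov v a) =
      η.vertDeriv cov v (a ∘L verticalLift v) (b ∘L verticalLift v) +
        (η.bivector v.proj (a ∘L verticalLift v) (b ∘L horizontalLift cov v) -
          η.bivector v.proj (b ∘L verticalLift v) (a ∘L horizontalLift cov v)) := by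
  rw [← η.apply_vertDerivSharp cov v, η.bivector_swap _ (b ∘L verticalLift v)]
  have h : b (η.tangentSharp cov v a) = b (verticalLift v
    (η.vertDerivSharp cov v (a ∘L verticalLift v) + η.sharp v.proj (a ∘L horizontalLift cov v))) +
      b (horizontalLift cov v (η.sharp v.proj (a ∘L verticalLift v))) := map_add _ _ _
  rw [h, map_add, map_add]
  simp only [bivector, ContinuousLinearMap.comp_apply]
  ring

theorem PoissonStructure.tangentSharp_antisymm (v : TangentBundle I M)
    (a b : TangentSpace I.tangent v →L[ℝ] ℝ) :
    b (η.tangentSharp cov v a) = -a (η.tangentSharp cov v b) := by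
  rw [η.apply_tangentSharp, η.apply_tangentSharp, η.vertDeriv_swap]
  ring

theorem PoissonStructure.bivectorBracket_tangentSharp (F G : TangentBundle I M → ℝ)
    (v : TangentBundle I M) :
    bivectorBracket (η.tangentSharp cov) F G v =
      η.vertDeriv cov v (dVert F v) (dVert G v) +
        (η.bivector v.proj (dVert F v) (dHor cov G v) -
          η.bivector v.proj (dVert G v) (dHor cov F v)) :=
  η.apply_tangentSharp cov v _ _

theorem PoissonStructure.tangentSharp_fun_fun {f g : M → ℝ} (hf : ContMDiff I 𝓘(ℝ, ℝ) ∞ f)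
    (hg : ContMDiff I 𝓘(ℝ, ℝ) ∞ g) (v : TangentBundle I M) :
    bivectorBracket (η.tangentSharp cov) (fun w ↦ f w.proj) (fun w ↦ g w.proj) v = 0 := by
  rw [η.bivectorBracket_tangentSharp, dVert_comp_proj hf, dVert_comp_proj hg,
    ← η.apply_vertDerivSharp]
  simp [bivector]

theorem PoissonStructure.tangentSharp_form_fun {α : ∀ x : M, Cotangent I x} (hα : IsSmoothForm α)
    {f : M → ℝ} (hf : ContMDiff I 𝓘(ℝ, ℝ) ∞ f) (v : TangentBundle I M) :
    bivectorBracket (η.tangentSharp cov) (formFun α) (fun w ↦ f w.proj) v =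
      mvfderiv I f v.proj (η.sharp v.proj (α v.proj)) := by
  rw [η.bivectorBracket_tangentSharp, dVert_formFun hα, dVert_comp_proj hf,
    dHor_comp_proj cov hf, ← η.apply_vertDerivSharp]
  simp [bivector]

theorem PoissonStructure.tangentSharp_form_form (htorsion : cov.torsion = 0)
    {α β : ∀ x : M, Cotangent I x} (hα : IsSmoothForm α) (hαc : IsClosedForm α)
    (hβ : IsSmoothForm β) (hβc : IsClosedForm β) (v : TangentBundle I M) :
    bivectorBracket (η.tangentSharp cov) (formFun α) (formFun β) v =
      mvfderiv I (fun y ↦ η.bivector y (α y) (β y)) v.proj v.2 := by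
  have key : ∀ {γ : ∀ x : M, Cotangent I x} (hγ : IsSmoothForm γ), IsClosedForm γ →
      dHor cov (formFun γ) v = covDerivForm cov γ (hγ.diffFormAt v.proj) v.2 := by
    intro γ hγ hγc
    ext u
    rw [dHor_formFun cov hγ, covDerivForm_symm cov htorsion hγc]
  rw [η.bivectorBracket_tangentSharp, dVert_formFun hα, dVert_formFun hβ, key hα hαc, key hβ hβc,
    η.vertDeriv_eq_covDeriv cov v (hα.diffFormAt _) (hβ.diffFormAt _), covDeriv,
    η.bivector_swap _ (β v.proj)]
  ring

theorem PoissonStructure.tangentSharp_lift_lift (htorsion : cov.torsion = 0)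
    {f h g k : M → ℝ} (hf : ContMDiff I 𝓘(ℝ, ℝ) ∞ f) (hh : ContMDiff I 𝓘(ℝ, ℝ) ∞ h)
    (hg : ContMDiff I 𝓘(ℝ, ℝ) ∞ g) (hk : ContMDiff I 𝓘(ℝ, ℝ) ∞ k) :
    bivectorBracket (η.tangentSharp cov) (tangentLift I f h) (tangentLift I g k) =
      tangentLift I (η.bracket f g) (η.bracket f k + η.bracket h g) := by
  have hf' := isSmoothForm_mvfderiv hf
  have hg' := isSmoothForm_mvfderiv hg
  funext v
  exact bivectorBracket_tangentLift (η.tangentSharp_antisymm cov) hf hh hg hk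
    (η.tangentSharp_form_form cov htorsion hf' (isClosedForm_mvfderiv hf) hg'
      (isClosedForm_mvfderiv hg) v)
    (η.tangentSharp_form_fun cov hf' hk v) (η.tangentSharp_form_fun cov hg' hh v)
    (η.tangentSharp_fun_fun cov hh hk v)

theorem PoissonStructure.jacobi_tangentLift (htorsion : cov.torsion = 0) {f f' g g' h h' : M → ℝ}
    (hf : ContMDiff I 𝓘(ℝ, ℝ) ∞ f) (hf' : ContMDiff I 𝓘(ℝ, ℝ) ∞ f')
    (hg : ContMDiff I 𝓘(ℝ, ℝ) ∞ g) (hg' : ContMDiff I 𝓘(ℝ, ℝ) ∞ g')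
    (hh : ContMDiff I 𝓘(ℝ, ℝ) ∞ h) (hh' : ContMDiff I 𝓘(ℝ, ℝ) ∞ h') :
    bivectorBracket (η.tangentSharp cov) (tangentLift I f f')
        (bivectorBracket (η.tangentSharp cov) (tangentLift I g g') (tangentLift I h h')) +
      bivectorBracket (η.tangentSharp cov) (tangentLift I g g')
        (bivectorBracket (η.tangentSharp cov) (tangentLift I h h') (tangentLift I f f')) +
      bivectorBracket (η.tangentSharp cov) (tangentLift I h h')
        (bivectorBracket (η.tangentSharp cov) (tangentLift I f f') (tangentLift I g g')) = 0 := by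
  have hb : ∀ {a b : M → ℝ}, ContMDiff I 𝓘(ℝ, ℝ) ∞ a → ContMDiff I 𝓘(ℝ, ℝ) ∞ b →
    ContMDiff I 𝓘(ℝ, ℝ) ∞ (η.bracket a b) := fun ha hb ↦ η.contMDiff_bracket ha hb
  have hJ : ∀ {a b c : M → ℝ}, ContMDiff I 𝓘(ℝ, ℝ) ∞ a → ContMDiff I 𝓘(ℝ, ℝ) ∞ b →
      ContMDiff I 𝓘(ℝ, ℝ) ∞ c → η.bracket a (η.bracket b c) + η.bracket b (η.bracket c a) +
        η.bracket c (η.bracket a b) = 0 := fun ha hb hc ↦ funext fun x ↦ η.jacobi _ _ _ ha hb hc x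
  have e1 := hb hg hh
  have e2 := hb hh hf
  have e3 := hb hf hg
  rw [η.tangentSharp_lift_lift cov htorsion hg hg' hh hh',
    η.tangentSharp_lift_lift cov htorsion hh hh' hf hf',
    η.tangentSharp_lift_lift cov htorsion hf hf' hg hg',
    η.tangentSharp_lift_lift cov htorsion hf hf' e1 ((hb hg hh').add (hb hg' hh)),
    η.tangentSharp_lift_lift cov htorsion hg hg' e2 ((hb hh hf').add (hb hh' hf)),
    η.tangentSharp_lift_lift cov htorsion hh hh' e3 ((hb hf hg').add (hb hf' hg)),
    tangentLift_add (hb hf e1) (hb hg e2), tangentLift_add ((hb hf e1).add (hb hg e2)) (hb hh e3),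
    hJ hf hg hh, η.bracket_add (hb hg hh') (hb hg' hh), η.bracket_add (hb hh hf') (hb hh' hf),
    η.bracket_add (hb hf hg') (hb hf' hg)]
  have j1 := hJ hf' hg hh
  have j2 := hJ hf hg' hh
  have j3 := hJ hf hg hh'
  have h0 : η.bracket f (η.bracket g h') + η.bracket f (η.bracket g' h) +
      η.bracket f' (η.bracket g h) + (η.bracket g (η.bracket h f') + η.bracket g (η.bracket h' f) +
        η.bracket g' (η.bracket h f)) + (η.bracket h (η.bracket f g') +
          η.bracket h (η.bracket f' g) + η.bracket h' (η.bracket f g)) = 0 := by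
    linear_combination j1 + j2 + j3
  rw [h0]
  funext v
  change mvfderiv I (0 : M → ℝ) v.proj v.2 + 0 = 0
  simp

theorem PoissonStructure.contMDiff_tangentSharp (htorsion : cov.torsion = 0)
    {F G : TangentBundle I M → ℝ} (hF : ContMDiff I.tangent 𝓘(ℝ, ℝ) ∞ F)
    (hG : ContMDiff I.tangent 𝓘(ℝ, ℝ) ∞ G) :
    ContMDiff I.tangent 𝓘(ℝ, ℝ) ∞ (bivectorBracket (η.tangentSharp cov) F G) := by
  refine (generatesCotangent_tangentLifts cov).contMDiff_bivectorBracket ?_ hF hG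
  rintro _ ⟨f, h, hf, hh, rfl⟩ _ ⟨g, k, hg, hk, rfl⟩
  rw [η.tangentSharp_lift_lift cov htorsion hf hh hg hk]
  exact contMDiff_tangentLift (η.contMDiff_bracket hf hg)
    ((η.contMDiff_bracket hf hk).add (η.contMDiff_bracket hh hg))

/-- The Lie–Poisson structure of the tangent bundle of a Poisson manifold. -/
def PoissonStructure.tangent (htorsion : cov.torsion = 0) :
    PoissonStructure I.tangent (TangentBundle I M) where
  sharp := η.tangentSharp cov
  antisymm := η.tangentSharp_antisymm cov
  smooth _ _ hF hG := η.contMDiff_tangentSharp cov htorsion hF hG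
  jacobi _ _ _ hF hG hK x := by
    refine (generatesCotangent_tangentLifts cov).jacobi (η.tangentSharp_antisymm cov)
      (fun _ _ hF hG ↦ η.contMDiff_tangentSharp cov htorsion hF hG) ?_ hF hG hK x
    rintro _ ⟨f, f', hf, hf', rfl⟩ _ ⟨g, g', hg, hg', rfl⟩ _ ⟨h, h', hh, hh', rfl⟩ x
    exact congrFun (η.jacobi_tangentLift cov htorsion hf hf' hg hg' hh hh') x

theorem PoissonStructure.isLiePoisson_tangent (htorsion : cov.torsion = 0) :
    IsLiePoisson η (η.tangent cov htorsion) where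
  form_form _ _ hα hαc hβ hβc v :=
    (η.tangentSharp_form_form cov htorsion hα hαc hβ hβc v).trans
      (η.formBracket_eq_mvfderiv hα hαc hβ hβc _ _).symm
  fun_fun _ _ hf hg v := η.tangentSharp_fun_fun cov hf hg v
  form_fun _ _ hα _ hf v := η.tangentSharp_form_fun cov hα hf v

theorem PoissonStructure.bracketRC_tangent {𝕜 : Type*} [RCLike 𝕜] (htorsion : cov.torsion = 0)
    (f g : TangentBundle I M → 𝕜) (v : TangentBundle I M) :
    (η.tangent cov htorsion).bracketRC f g v =
      pairWedge (η.vertDeriv cov v) (dVert f v) (dVert g v) +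
        (pairWedge (η.bivector v.proj) (dVert f v) (dHor cov g v) -
          pairWedge (η.bivector v.proj) (dVert g v) (dHor cov f v)) := by
  have h : ∀ a b : TangentSpace I.tangent v →L[ℝ] ℝ, (η.tangent cov htorsion).bivector v a b =
      η.vertDeriv cov v (a ∘L verticalLift v) (b ∘L verticalLift v) +
        (η.bivector v.proj (a ∘L verticalLift v) (b ∘L horizontalLift cov v) -
          η.bivector v.proj (b ∘L verticalLift v) (a ∘L horizontalLift cov v)) :=
    η.apply_tangentSharp cov v
  simp only [bracketRC, pairWedge, h, dVert, dHor, ContinuousLinearMap.comp_assoc]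
  push_cast
  ring

end LiePoisson

end

theorem mainTheorem6
    {E : Type*} [NormedAddCommGroup E] [NormedSpace ℝ E] [FiniteDimensional ℝ E]
    {H : Type*} [TopologicalSpace H] (I : ModelWithCorners ℝ E H) [I.Boundaryless]
    {P : Type*} [TopologicalSpace P] [ChartedSpace H P] [IsManifold I ∞ P] [T2Space P]
    (η : PoissonStructure I P)
    (cov : CovariantDerivative I E (TangentSpace I : P → Type _))
    (hsmooth : CovariantDerivative.ContMDiffCovariantDerivative cov ∞)
    (htorsion : cov.torsion = 0)
    (𝕜 : Type*) [RCLike 𝕜] :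
    ∃ θ : PoissonStructure I.tangent (TangentBundle I P),
      IsLiePoisson η θ ∧ (∀ θ', IsLiePoisson η θ' → θ' = θ) ∧
      ∀ f g : TangentBundle I P → 𝕜,
        ContMDiff I.tangent 𝓘(ℝ, 𝕜) ∞ f → ContMDiff I.tangent 𝓘(ℝ, 𝕜) ∞ g →
        ∀ v : TangentBundle I P,
          θ.bracketRC f g v =
            pairWedge (η.vertDeriv cov v) (dVert f v) (dVert g v) +
              (pairWedge (η.bivector v.proj) (dVert f v) (dHor cov g v) -
                pairWedge (η.bivector v.proj) (dVert g v) (dHor cov f v)) :=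
  ⟨η.tangent cov htorsion, η.isLiePoisson_tangent cov htorsion,
    fun _ h ↦ h.unique cov (η.isLiePoisson_tangent cov htorsion),
    fun f g _ _ v ↦ η.bracketRC_tangent cov htorsion f g v⟩
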